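/- **Setting.** Let $\bar H=\sum_{j=1}^M h_j\sigma_j$ be an $n$-qubit Hamiltonian with real $h_j$ and $n$-qubit Pauli operators $\sigma_j$, let $h_{tot}=\sum_j|h_j|>0$, and let $E_g$ be its ground-state energy. Let $O=\sum_j a_jO_j$ with real $a_j$, Hermitian unitary $O_j$ and $a_O=\sum_j|a_j|>0$. Let $|\Psi\rangle$ be a normalised initial state and let $p_g=|\langle\Psi_g|\Psi\rangle|^2$, where $|\Psi_g\rangle$ is a normalised ground state. For $\beta>0$ let $$\langle O\rangle(\beta)=\frac{\langle\Psi|e^{-\beta\bar H}Oe^{-\beta\bar H}|\Psi\rangle}{\langle\Psi|e^{-2\beta\bar H}|\Psi\rangle}.$$ (Replacing $\bar H$ by $H=\bar H-E_0$ does not change this value.) **LOR formula.** For $t\ne0$, $e^{-i\bar Ht}=\sum_s w_s(t)e^{i\theta_s(t)}U_s(t)$ with $w_s\ge 0$, where $s$ is either some $j\in\{1,\dots,M\}$, with $w_se^{i\theta_s}=|h_jt|/\sin\phi(t)$, $U_s=e^{-i\,\mathrm{sgn}(h_jt)\phi(t)\sigma_j}$, $\phi(t)=\arctan(h_{tot}|t|)$,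 or a tuple $(j_1,\dots,j_k)$ with $k\ge2$, $w_se^{i\theta_s}=\frac1{k!}\prod_a(-ih_{j_a}t)$, $U_s=\sigma_{j_k}\cdots\sigma_{j_1}$. With $N_t$ Trotter steps and $\mathbf S=(s_1,\dots,s_{N_t})$ put $U_{\mathbf S}(t)=U_{s_{N_t}}(t/N_t)\cdots U_{s_1}(t/N_t)$, $w_{\mathbf S}(t)=\prod_l w_{s_l}(t/N_t)$, $\theta_{\mathbf S}(t)=\sum_l\theta_{s_l}(t/N_t)$, and $C_A(t)=\sum_sw_s(t)$. **Algorithm.** The parameters are $E_0\in\mathbb R$, $\tau,T>0$ and integers $N_t,N_s\ge1$. Let $g(t)=\frac1\pi\frac{\beta}{\beta^2+t^2}e^{-(\beta^2+t^2)/(2\tau^2)}$ and $C_T=\int_{-T}^Tg(t)\,C_A(t/N_t)^{N_t}\,dt$. Draw $N_s$ independent samples. In each one, $(t,\mathbf S,t',\mathbf S')$ has density $C_T^{-2}g(t)g(t')w_{\mathbf S}(t)w_{\mathbf S'}(t')$ on $t,t'\in[-T,T]$, independently $j$ has probability $|a_j|/a_O$, and then one shot of each of two Hadamard-test circuits for the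 real and the imaginary part of $\langle\Psi|U_{\mathbf S'}(t')^\dagger O_jU_{\mathbf S}(t)|\Psi\rangle$ gives $\mu_R,\mu_I\in\{\pm1\}$ (independent given the rest), with these parts as expected values. Then $$\hat O=\frac{a_OC_T^2}{N_s}\sum_{l=1}^{N_s}\mathrm{sgn}(a_{j_l})\,e^{iE_0(t_l-t_l')}e^{i\theta_{\mathbf S_l}(t_l)}e^{-i\theta_{\mathbf S'_l}(t'_l)}(\mu_{R,l}+i\mu_{I,l}),$$ and $\hat{\mathbb 1}$ is computed in the same way, independently, for the identity operator (one term, coefficient $1$). **Theorem.** There are universal constants $c,C>0$ such that the following holds. Let $\beta,h_{tot},\eta,\kappa>0$, $\hat E_g\in\mathbb R$, $\delta E\ge0$ and $0<p_b\le1$. Then there are $\epsilon\in(0,1)$ with $$c\,p_b\,e^{-4\beta\delta E}\min\{\eta,1\}\le\epsilon\le C\,p_b\,e^{-4\beta\delta E}\,\eta$$ and parameters $E_0,\tau,T,N_t,N_s$, all depending only on $\beta,h_{tot},\hat E_g,\delta E,p_b,\eta,\kappa$, with $$N_t\le\Big\lceil C\,h_{tot}^2\beta^2\big(\ln\tfrac1\epsilon\big)^2\Big\rceil,\qquad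 N_s\le\Big\lceil\frac{C}{\kappa\epsilon^2}\Big\rceil,$$ such that for all $n$, $\bar H$, $O$, $|\Psi\rangle$ as above, with this value of $h_{tot}$, with $E_g\in[\hat E_g-\delta E,\hat E_g+\delta E]$ and with $p_g\ge p_b$, the data of the algorithm have a well-defined probability law (total mass $1$), and with probability higher than $1-\kappa$ one has $\hat{\mathbb 1}\ne0$ and $$\Big|\frac{\hat O}{\hat{\mathbb 1}}-\langle O\rangle(\beta)\Big|<a_O\,\eta.$$ -/

import Mathlib

open MeasureTheory
open scoped Kronecker Matrix

noncomputable section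

namespace ITS

/-! ### Qubits and Pauli operators -/

/-- Labels of the computational basis of `n` qubits. -/
abbrev Qubits (n : ℕ) : Type := Fin n → Fin 2

/-- Operators on `n` qubits. -/
abbrev Op (n : ℕ) : Type := Matrix (Qubits n) (Qubits n) ℂ

/-- State vectors of `n` qubits (not necessarily normalised). -/
abbrev Ket (n : ℕ) : Type := Qubits n → ℂ

/-- The inner product `⟨u|v⟩`, conjugate-linear in `u`. -/
def braket {ι : Type} [Fintype ι] (u v : ι → ℂ) : ℂ := star u ⬝ᵥ v

/-- Labels of the single-qubit Pauli operators. -/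
inductive Pauli
  | one
  | X
  | Y
  | Z

/-- The matrix of a single-qubit Pauli operator. -/
def Pauli.mat : Pauli → Matrix (Fin 2) (Fin 2) ℂ
  | .one => 1
  | .X => !![0, 1; 1, 0]
  | .Y => !![0, -Complex.I; Complex.I, 0]
  | .Z => !![1, 0; 0, -1]

/-- The `n`-qubit Pauli operator `P 0 ⊗ P 1 ⊗ ⋯ ⊗ P (n - 1)`. -/
def pauliString {n : ℕ} (P : Fin n → Pauli) : Op n :=
  Matrix.of fun x y => ∏ k, (P k).mat (x k) (y k)

/-- A Hamiltonian on `n` qubits, given as a real linear combination `∑ j, h j • σ j` of Pauli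
operators. -/
structure PauliHamiltonian (n : ℕ) where
  /-- the number of terms -/
  M : ℕ
  /-- the coefficients -/
  h : Fin M → ℝ
  /-- the Pauli operators -/
  P : Fin M → Fin n → Pauli

/-- An observable on `n` qubits, given as a real linear combination `∑ j, a j • op j` of Hermitian
unitary operators. -/
structure Observable (n : ℕ) where
  /-- the number of terms -/
  K : ℕ
  /-- the coefficients -/
  a : Fin K → ℝ
  /-- the Hermitian unitary operators -/
  op : Fin K → Op n
  isHermitian : ∀ j, (op j).IsHermitian
  isUnitary : ∀ j, op j ∈ Matrix.unitaryGroup (Qubits n) ℂ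

namespace Observable

variable {n : ℕ}

/-- The operator `O = ∑ j, a j • op j`. -/
def toOp (O : Observable n) : Op n := ∑ j, (O.a j : ℂ) • O.op j

/-- `a_O = ∑ j, |a j|`. -/
def aTot (O : Observable n) : ℝ := ∑ j, |O.a j|

/-- The identity operator, as a linear combination with the single coefficient `1`. -/
def identity (n : ℕ) : Observable n where
  K := 1
  a := fun _ => 1
  op := fun _ => 1
  isHermitian := fun _ => Matrix.isHermitian_one
  isUnitary := fun _ => one_mem _

end Observable

/-! ### The zeroth-order leading-order-rotation (LOR) formula -/

/-- Labels `s` of the terms of the zeroth-order LOR formula for a Hamiltonian with `M` terms: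
either a rotation `j`, or a tuple `(j₁, …, jₖ)` with `k ≥ 2`. -/
def LORLabel (M : ℕ) : Type := Fin M ⊕ (Σ k : ℕ, (Fin (k + 2) → Fin M))

instance (M : ℕ) : Countable (LORLabel M) :=
  inferInstanceAs (Countable (Fin M ⊕ (Σ k : ℕ, (Fin (k + 2) → Fin M))))

instance (M : ℕ) : MeasurableSpace (LORLabel M) := ⊤

instance (M : ℕ) : DiscreteMeasurableSpace (LORLabel M) := ⟨fun _ => trivial⟩

namespace PauliHamiltonian

variable {n : ℕ} (H : PauliHamiltonian n)

/-- The Pauli operator `σ j`. -/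
def sigma (j : Fin H.M) : Op n := pauliString (H.P j)

/-- The operator `∑ j, h j • σ j`. -/
def toOp : Op n := ∑ j, (H.h j : ℂ) • H.sigma j

/-- `h_tot = ∑ j, |h j|`. -/
def hTot : ℝ := ∑ j, |H.h j|

/-- The rotation angle `φ(t) = arctan (h_tot |t|)`. -/
def phi (t : ℝ) : ℝ := Real.arctan (H.hTot * |t|)

/-- The unitary `U_s(t)`: the rotation `exp (-i sgn(h_j t) φ(t) σ_j)` for `s = j`, and the product
`σ_{jₖ} ⋯ σ_{j₁}` for `s = (j₁, …, jₖ)`. -/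
def lorU (t : ℝ) : LORLabel H.M → Op n
  | .inl j =>
      NormedSpace.exp ((-(Complex.I * (Real.sign (H.h j * t) : ℂ) * (H.phi t : ℂ))) • H.sigma j)
  | .inr ⟨_, J⟩ => (List.ofFn fun a => H.sigma (J a)).reverse.prod

/-- The coefficient `w_s(t) exp (i θ_s(t))` of `U_s(t)`: `|h_j t| / sin φ(t)` for `s = j`, and
`(1 / k!) ∏ a, (-i h_{jₐ} t)` for `s = (j₁, …, jₖ)`. -/
def lorCoeff (t : ℝ) : LORLabel H.M → ℂ
  | .inl j => ((|H.h j * t| / Real.sin (H.phi t) : ℝ) : ℂ)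
  | .inr ⟨k, J⟩ =>
      (1 / ((k + 2).factorial : ℂ)) * ∏ a, (-(Complex.I * (H.h (J a) : ℂ) * (t : ℂ)))

/-- The weight `w_s(t)`. -/
def lorWeight (t : ℝ) (s : LORLabel H.M) : ℝ := ‖H.lorCoeff t s‖

/-- The phase `θ_s(t)`. -/
def lorTheta (t : ℝ) (s : LORLabel H.M) : ℝ := (H.lorCoeff t s).arg

/-- `C_A(t) = ∑ s, w_s(t)`. -/
def CA (t : ℝ) : ℝ := ∑' s, H.lorWeight t s

/-- `U_𝐒(t) = U_{s_{N_t}}(t / N_t) ⋯ U_{s_1}(t / N_t)` for a sequence `𝐒` of `N_t` labels. -/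
def seqU {Nt : ℕ} (t : ℝ) (S : Fin Nt → LORLabel H.M) : Op n :=
  (List.ofFn fun l => H.lorU (t / Nt) (S l)).reverse.prod

/-- `w_𝐒(t)`, the product of the weights of the `N_t` steps. -/
def seqWeight {Nt : ℕ} (t : ℝ) (S : Fin Nt → LORLabel H.M) : ℝ :=
  ∏ l, H.lorWeight (t / Nt) (S l)

/-- `θ_𝐒(t)`, the sum of the phases of the `N_t` steps. -/
def seqTheta {Nt : ℕ} (t : ℝ) (S : Fin Nt → LORLabel H.M) : ℝ :=
  ∑ l, H.lorTheta (t / Nt) (S l)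

end PauliHamiltonian

/-! ### The Hadamard-test circuit -/

/-- The gate that applies `A` to the system if the ancillary qubit is in the state `b`. -/
def ctrl {n : ℕ} (b : Fin 2) (A : Op n) : Matrix (Qubits n × Fin 2) (Qubits n × Fin 2) ℂ :=
  Matrix.blockDiagonal fun i => if i = b then A else 1

/-- The final state of the Hadamard test: starting from `|Ψ⟩ ⊗ |+⟩`, the gates `V` and then `W` are
controlled on the state `1` of the ancillary qubit, and `V'` is controlled on the state `0`. -/
def hadamardState {n : ℕ} (V' W V : Op n) (Ψ : Ket n) : Qubits n × Fin 2 → ℂ :=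
  (ctrl 0 V' * ctrl 1 W * ctrl 1 V) *ᵥ fun p => Ψ p.1 * (1 / Real.sqrt 2 : ℝ)

/-- A measurement outcome `±1`. -/
def outcome (b : Bool) : ℝ := if b then 1 else -1

/-- Born rule: the probability of the outcome `±1` when the Pauli operator `Q` of the ancillary
qubit is measured in the state `φ`. -/
def ancillaProb {n : ℕ} (Q : Pauli) (φ : Qubits n × Fin 2 → ℂ) (b : Bool) : ℝ :=
  (braket φ (((1 : Op n) ⊗ₖ ((1 / 2 : ℂ) • (1 + (outcome b : ℂ) • Q.mat))) *ᵥ φ)).re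

/-! ### The algorithm -/

/-- The Lorentz-Gaussian function `g`. -/
def g (β τ t : ℝ) : ℝ :=
  1 / Real.pi * (β / (β ^ 2 + t ^ 2)) * Real.exp (-((β ^ 2 + t ^ 2) / (2 * τ ^ 2)))

/-- The tunable parameters of the algorithm: the energy shift `E₀`, the width `τ` of the Gaussian,
the truncation time `T`, the number `N_t` of Trotter steps, and the number `N_s` of samples. -/
structure Params where
  E₀ : ℝ
  τ : ℝ
  T : ℝ
  Nt : ℕ
  Ns : ℕ

section Algorithm

variable {n : ℕ} (H : PauliHamiltonian n) (β : ℝ) (p : Params) (Ψ : Ket n)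

/-- `C_T = ∫_{-T}^{T} g(t) C_A(t / N_t) ^ N_t dt`. -/
def CT : ℝ := ∫ t in (-p.T)..p.T, g β p.τ t * H.CA (t / p.Nt) ^ p.Nt

variable (O : Observable n)

/-- The random data of one sample: `((t, 𝐒), (t', 𝐒'), j, μ_R, μ_I)`, where `μ_R` and `μ_I` are the
outcomes of one shot of the circuit for the real part and of one shot of the circuit for the
imaginary part. -/
abbrev Sample : Type :=
  (ℝ × (Fin p.Nt → LORLabel H.M)) × (ℝ × (Fin p.Nt → LORLabel H.M)) × Fin O.K × Bool × Bool

/-- The joint density of a sample: `(t, 𝐒, t', 𝐒')` has the density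
`C_T⁻² g(t) g(t') w_𝐒(t) w_𝐒'(t')` on `[-T, T]²`, independently `j` has the probability
`|a_j| / a_O`, and given these, the outcomes of the two circuits are independent, the ancillary
Pauli operator `X` being measured in the first circuit and `Y` in the second. -/
def sampleDensity : Sample H p O → ℝ
  | ((t, S), (t', S'), j, bR, bI) =>
      (CT H β p ^ 2)⁻¹ * g β p.τ t * g β p.τ t' * H.seqWeight t S * H.seqWeight t' S'
        * (|O.a j| / O.aTot)
        * ancillaProb .X (hadamardState (H.seqU t' S') (O.op j) (H.seqU t S) Ψ) bR
        * ancillaProb .Y (hadamardState (H.seqU t' S') (O.op j) (H.seqU t S) Ψ) bI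

/-- The law of one sample. -/
def sampleLaw : Measure (Sample H p O) :=
  (((volume.restrict (Set.Icc (-p.T) p.T)).prod Measure.count).prod
    (((volume.restrict (Set.Icc (-p.T) p.T)).prod Measure.count).prod
      Measure.count)).withDensity fun ω => ENNReal.ofReal (sampleDensity H β p Ψ O ω)

/-- The contribution of one sample to the estimator:
`sgn(a_j) exp (i E₀ (t - t')) exp (i θ_𝐒(t)) exp (-i θ_𝐒'(t')) (μ_R + i μ_I)`. -/
def sampleValue : Sample H p O → ℂ
  | ((t, S), (t', S'), j, bR, bI) =>
      (Real.sign (O.a j) : ℂ) * Complex.exp (Complex.I * p.E₀ * (t - t'))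
        * Complex.exp (Complex.I * H.seqTheta t S) * Complex.exp (-(Complex.I * H.seqTheta t' S'))
        * (outcome bR + Complex.I * outcome bI)

/-- The estimator `Ô = (a_O C_T² / N_s) ∑ l, sampleValue (ω l)` of `⟨Ψ|e^{-βH} O e^{-βH}|Ψ⟩` with
`H = H̄ - E₀`, where two circuit shots (one for each of the real and imaginary parts) are made for
each of the `N_s` samples. -/
def estimator (ω : Fin p.Ns → Sample H p O) : ℂ :=
  ((O.aTot * CT H β p ^ 2 / p.Ns : ℝ) : ℂ) * ∑ l, sampleValue H p O (ω l)

/-- The law of all random data of imaginary-time simulation: `N_s` independent samples for the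
observable `O` (numerator), and independently `N_s` independent samples for the identity operator
(denominator). -/
def itsLaw :
    Measure ((Fin p.Ns → Sample H p O) × (Fin p.Ns → Sample H p (Observable.identity n))) :=
  (Measure.pi fun _ => sampleLaw H β p Ψ O).prod
    (Measure.pi fun _ => sampleLaw H β p Ψ (Observable.identity n))

end Algorithm

/-! ### The target -/

/-- The expected value `⟨O⟩(β)` of `O` in the state evolved from `Ψ` for the imaginary time `β`.
Subtracting a constant from the Hamiltonian `A` does not change it. -/
def imagTimeMean {n : ℕ} (A : Op n) (β : ℝ) (Ψ : Ket n) (O : Op n) : ℂ :=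
  braket Ψ ((NormedSpace.exp ((-β : ℂ) • A) * O * NormedSpace.exp ((-β : ℂ) • A)) *ᵥ Ψ) /
    braket Ψ (NormedSpace.exp ((-(2 * β) : ℂ) • A) *ᵥ Ψ)

end ITS

end

open ITS

namespace ITS

/-! ### The Lorentz–Gaussian function -/

/-! The algorithm replaces $e^{-\beta x}$ by a truncated Fourier integral of $g$ and estimates that
integral by sampling. Put $L=\ln(1/\epsilon)$.

Bias. The Fourier transform of $g$ at $x$ equals $e^{-\beta^2/2\tau^2}\,\mathbb E\,e^{-\beta|Y|}$
with $Y$ Gaussian of mean $x$ and variance $1/\tau^2$ (`fourier_g`). Without the absolute value this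
would be exactly $e^{-\beta x}$, so the error comes only from $Y<0$ and is at most
$e^{-\tau^2x^2/2}$ (`norm_fourier_g_sub_exp_le`). Cutting the integral at $\pm T$ costs at most
$e^{-T^2/2\tau^2}$. The shift $E_0$ lies at least $1/\beta$ below the spectrum, so
$\tau^2=2\beta^2L$ and $T=2\beta L$ make both errors at most $\epsilon$.

Unbiasedness. The LOR expansion is exact at every Trotter step, so summing the weighted paths at
fixed $t$ gives $e^{-i\bar Ht}$ (`hasSum_seqCoeff_smul_seqU`). A sample is sesquilinear in two
independent paths, so the estimator has mean $\langle v|O|v\rangle$, where $v$ (`meanKet`) is the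
truncated Fourier transform of $g$ applied to $\bar H-E_0$ and $\Psi$. This $v$ is within
$2\epsilon$ of $v_0=e^{-\beta(\bar H-E_0)}\Psi$.

Fluctuations. The LOR weights have no first-order excess: $C_A(t)\le e^{\frac32(h_{tot}t)^2}$ for
$h_{tot}|t|\le1$. Hence $N_t\ge(h_{tot}T)^2$ keeps $C_T$ below a universal constant (`CT_le`), and
Chebyshev's inequality gives accuracy $a_O\epsilon$ with $N_s\sim1/(\kappa\epsilon^2)$.

Quotient. The component along the ground state gives $\|v_0\|^2\ge p_be^{-4\beta\delta E}/8$. Taking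
$\epsilon$ to be a small multiple of $p_be^{-4\beta\delta E}\min\{\eta,1\}$ keeps the denominator
away from $0$ and the quotient within $a_O\eta$ (`norm_div_sub_div_lt`). -/

theorem g_nonneg {β : ℝ} (hβ : 0 < β) (τ t : ℝ) : 0 ≤ g β τ t := by
  unfold g; have := Real.pi_pos; positivity

theorem g_pos {β : ℝ} (hβ : 0 < β) (τ t : ℝ) : 0 < g β τ t := by
  unfold g; have := Real.pi_pos; positivity

theorem continuous_g {β : ℝ} (hβ : 0 < β) (τ : ℝ) : Continuous (g β τ) := by
  unfold g
  have h : ∀ t : ℝ, β ^ 2 + t ^ 2 ≠ 0 := fun t => by positivity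
  fun_prop (disch := exact h)

/-- The Lorentzian probability density of width `β`. -/
noncomputable def lorentz (β t : ℝ) : ℝ := 1 / Real.pi * (β / (β ^ 2 + t ^ 2))

theorem lorentz_nonneg {β : ℝ} (hβ : 0 < β) (t : ℝ) : 0 ≤ lorentz β t := by
  unfold lorentz; have := Real.pi_pos; positivity

theorem lorentz_eq {β : ℝ} (hβ : 0 < β) (t : ℝ) :
    lorentz β t = 1 / (Real.pi * β) * (1 + (t / β) ^ 2)⁻¹ := by
  unfold lorentz
  have : β ^ 2 + t ^ 2 ≠ 0 := by positivity
  have h2 : 1 + (t / β) ^ 2 ≠ 0 := by positivity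
  field_simp

theorem integrable_lorentz {β : ℝ} (hβ : 0 < β) : Integrable (lorentz β) := by
  have : lorentz β = fun t => 1 / (Real.pi * β) * (1 + (t / β) ^ 2)⁻¹ := funext (lorentz_eq hβ)
  rw [this]
  exact (integrable_inv_one_add_sq.comp_div hβ.ne').const_mul _

theorem integral_lorentz {β : ℝ} (hβ : 0 < β) : ∫ t, lorentz β t = 1 := by
  simp_rw [lorentz_eq hβ]
  rw [integral_const_mul, Measure.integral_comp_div (fun t : ℝ => (1 + t ^ 2)⁻¹),
    integral_univ_inv_one_add_sq, abs_of_pos hβ, smul_eq_mul]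
  have := Real.pi_pos
  field_simp

theorem g_eq_lorentz_mul (β τ t : ℝ) :
    g β τ t = lorentz β t * Real.exp (-((β ^ 2 + t ^ 2) / (2 * τ ^ 2))) := rfl

theorem g_le_lorentz {β : ℝ} (hβ : 0 < β) (τ t : ℝ) : g β τ t ≤ lorentz β t := by
  rw [g_eq_lorentz_mul]
  refine mul_le_of_le_one_right (lorentz_nonneg hβ t) (Real.exp_le_one_iff.2 ?_)
  rw [neg_nonpos]; positivity

theorem integrable_g {β : ℝ} (hβ : 0 < β) (τ : ℝ) : Integrable (g β τ) := by
  refine (integrable_lorentz hβ).mono (continuous_g hβ τ).aestronglyMeasurable (ae_of_all _ ?_)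
  intro t
  rw [Real.norm_of_nonneg (g_nonneg hβ τ t), Real.norm_of_nonneg (lorentz_nonneg hβ t)]
  exact g_le_lorentz hβ τ t

/-! ### Fourier transform of the Lorentz–Gaussian function -/

/-- This writes the Lorentzian as a superposition of phases. Substituted into the transform of `g`,
it leaves only a Gaussian integral in `t`, and no contour integration is needed. -/
theorem integral_two_sided_exp {β : ℝ} (hβ : 0 < β) (t : ℝ) :
    Integrable (fun y : ℝ => (Real.exp (-(β * |y|)) : ℂ) * Complex.exp (Complex.I * y * t)) ∧
    ∫ y : ℝ, (Real.exp (-(β * |y|)) : ℂ) * Complex.exp (Complex.I * y * t)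
      = 2 * β / (β ^ 2 + t ^ 2) := by
  set f : ℝ → ℂ := fun y : ℝ => (Real.exp (-(β * |y|)) : ℂ) * Complex.exp (Complex.I * y * t)
  have h1 : Set.EqOn f (fun y : ℝ => Complex.exp ((β + Complex.I * t) * y)) (Set.Iic 0) := by
    intro y hy
    simp only [f, abs_of_nonpos (Set.mem_Iic.1 hy), Complex.ofReal_exp, ← Complex.exp_add]
    congr 1; push_cast; ring
  have h2 : Set.EqOn f (fun y : ℝ => Complex.exp ((-β + Complex.I * t) * y)) (Set.Ioi 0) := by
    intro y hy
    simp only [f, abs_of_pos (Set.mem_Ioi.1 hy), Complex.ofReal_exp, ← Complex.exp_add]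
    congr 1; push_cast; ring
  have hp : 0 < ((β : ℂ) + Complex.I * t).re := by simpa using hβ
  have hm : (-(β : ℂ) + Complex.I * t).re < 0 := by simpa using hβ
  have i1 : IntegrableOn f (Set.Iic 0) :=
    (integrableOn_exp_mul_complex_Iic hp 0).congr_fun h1.symm measurableSet_Iic
  have i2 : IntegrableOn f (Set.Ioi 0) :=
    (integrableOn_exp_mul_complex_Ioi hm 0).congr_fun h2.symm measurableSet_Ioi
  have hint : Integrable f := by
    rw [← integrableOn_univ, ← Set.Iic_union_Ioi (a := (0 : ℝ))]; exact i1.union i2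
  refine ⟨hint, ?_⟩
  rw [← integral_add_compl measurableSet_Iic hint, Set.compl_Iic,
    setIntegral_congr_fun measurableSet_Iic h1, setIntegral_congr_fun measurableSet_Ioi h2,
    integral_exp_mul_complex_Iic hp, integral_exp_mul_complex_Ioi hm]
  have hp' : (β : ℂ) + Complex.I * t ≠ 0 := fun h => by simp [h] at hp
  have hm' : -(β : ℂ) + Complex.I * t ≠ 0 := fun h => by simp [h] at hm
  have h3 : (β : ℂ) ^ 2 + t ^ 2 ≠ 0 := by
    have : (β : ℂ) ^ 2 + t ^ 2 = -((β + Complex.I * t) * (-β + Complex.I * t)) := by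
      ring_nf; rw [Complex.I_sq]; ring
    rw [this]; exact neg_ne_zero.2 (mul_ne_zero hp' hm')
  simp only [Complex.ofReal_zero, mul_zero, Complex.exp_zero]
  field_simp
  ring_nf
  rw [Complex.I_sq]; ring

/-- The Gaussian density with mean `x` and standard deviation `1 / τ`. -/
noncomputable def gauss (τ x y : ℝ) : ℝ :=
  τ / √(2 * Real.pi) * Real.exp (-(τ ^ 2 / 2) * (y - x) ^ 2)

/-- Completing the square: an exponential tilt shifts the mean by `s / τ ^ 2` and rescales. It is
used with `s = β` for the main term and with `s = τ ^ 2 * x` for the error. -/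
theorem exp_mul_gauss {τ : ℝ} (hτ : 0 < τ) (s x y : ℝ) :
    Real.exp (-(s * y)) * gauss τ x y
      = Real.exp (-(s * x) + s ^ 2 / (2 * τ ^ 2)) * gauss τ (x - s / τ ^ 2) y := by
  unfold gauss
  rw [mul_left_comm, mul_left_comm (Real.exp _), ← Real.exp_add, ← Real.exp_add]
  congr 2; field_simp; ring

theorem integrable_gauss {τ : ℝ} (hτ : 0 < τ) (x : ℝ) : Integrable (gauss τ x) :=
  ((integrable_exp_neg_mul_sq (b := τ ^ 2 / 2) (by positivity)).comp_sub_right x).const_mul _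

theorem integral_gauss {τ : ℝ} (hτ : 0 < τ) (x : ℝ) : ∫ y, gauss τ x y = 1 := by
  unfold gauss
  rw [integral_const_mul, integral_sub_right_eq_self (fun y => Real.exp (-(τ ^ 2 / 2) * y ^ 2)) x,
    integral_gaussian]
  have : Real.pi / (τ ^ 2 / 2) = (2 * Real.pi) / τ ^ 2 := by field_simp
  rw [this, Real.sqrt_div' _ (by positivity), Real.sqrt_sq hτ.le]
  have : √(2 * Real.pi) ≠ 0 := by have := Real.pi_pos; positivity
  field_simp

theorem gauss_nonneg {τ : ℝ} (hτ : 0 < τ) (x y : ℝ) : 0 ≤ gauss τ x y := by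
  unfold gauss; have := Real.pi_pos; positivity

theorem integrable_exp_mul_gauss {τ : ℝ} (hτ : 0 < τ) (s x : ℝ) :
    Integrable fun y => Real.exp (-(s * y)) * gauss τ x y := by
  simp_rw [exp_mul_gauss hτ]
  exact (integrable_gauss hτ _).const_mul _

theorem integral_exp_mul_gauss {τ : ℝ} (hτ : 0 < τ) (s x : ℝ) :
    ∫ y, Real.exp (-(s * y)) * gauss τ x y = Real.exp (-(s * x) + s ^ 2 / (2 * τ ^ 2)) := by
  simp_rw [exp_mul_gauss hτ, integral_const_mul, integral_gauss hτ, mul_one]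

theorem integral_gaussian_fourier {τ : ℝ} (hτ : 0 < τ) (x y : ℝ) :
    ∫ t : ℝ, Complex.exp (Complex.I * (y - x : ℝ) * t) * Real.exp (-(1 / (2 * τ ^ 2)) * t ^ 2)
      = (2 * Real.pi * gauss τ x y : ℝ) := by
  have hb : 0 < ((1 / (2 * τ ^ 2) : ℝ) : ℂ).re := by rw [Complex.ofReal_re]; positivity
  have := fourierIntegral_gaussian hb ((y - x : ℝ) : ℂ)
  calc _ = _ := integral_congr_ae (ae_of_all _ fun t => by
            simp only [Complex.ofReal_exp]; push_cast; rfl)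
    _ = _ := this
    _ = _ := by
      have h1 : (Real.pi : ℂ) / ((1 / (2 * τ ^ 2) : ℝ) : ℂ)
          = ((Real.pi / (1 / (2 * τ ^ 2)) : ℝ) : ℂ) := by push_cast; rfl
      have hpi := Real.pi_pos
      have h2 : ((1 : ℂ) / 2) = ((1 / 2 : ℝ) : ℂ) := by push_cast; rfl
      rw [h1, h2, ← Complex.ofReal_cpow (by positivity), ← Real.sqrt_eq_rpow]
      have h3 : -((y - x : ℝ) : ℂ) ^ 2 / (4 * ((1 / (2 * τ ^ 2) : ℝ) : ℂ))
          = ((-(τ ^ 2 / 2) * (y - x) ^ 2 : ℝ) : ℂ) := by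
        have : (τ : ℂ) ≠ 0 := by exact_mod_cast hτ.ne'
        push_cast; field_simp; ring
      rw [h3, ← Complex.ofReal_exp, ← Complex.ofReal_mul]
      congr 1
      unfold gauss
      have h4 : Real.pi / (1 / (2 * τ ^ 2)) = (2 * Real.pi) * τ ^ 2 := by field_simp
      rw [h4, Real.sqrt_mul (by positivity), Real.sqrt_sq hτ.le]
      have h5 : √(2 * Real.pi) * √(2 * Real.pi) = 2 * Real.pi := Real.mul_self_sqrt (by positivity)
      have : √(2 * Real.pi) ≠ 0 := by positivity
      generalize √(2 * Real.pi) = r at h5 this ⊢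
      rw [← h5]; field_simp

/-- The transform of a product is a convolution, here of the two-sided exponential with a Gaussian
density. The interchange of integrals is justified because `F` has the modulus of a product of two
integrable functions. -/
theorem fourier_g {β τ : ℝ} (hβ : 0 < β) (hτ : 0 < τ) (x : ℝ) :
    ∫ t : ℝ, (g β τ t : ℂ) * Complex.exp (-(Complex.I * x * t))
      = (Real.exp (-(β ^ 2 / (2 * τ ^ 2))) * ∫ y, Real.exp (-(β * |y|)) * gauss τ x y : ℝ) := by
  have hpi := Real.pi_pos
  have hpi' : (Real.pi : ℂ) ≠ 0 := by exact_mod_cast hpi.ne'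
  set E : ℝ := Real.exp (-(β ^ 2 / (2 * τ ^ 2)))
  let F : ℝ → ℝ → ℂ := fun t y => (Real.exp (-(β * |y|)) : ℂ) *
    (Complex.exp (Complex.I * (y - x : ℝ) * t) * Real.exp (-(1 / (2 * τ ^ 2)) * t ^ 2))
  have h1 : ∀ t : ℝ, (g β τ t : ℂ) * Complex.exp (-(Complex.I * x * t))
      = (E / (2 * Real.pi) : ℂ) * ∫ y : ℝ, F t y := by
    intro t
    have e1 : ∀ y : ℝ, F t y = (Complex.exp (-(Complex.I * x * t))
          * Real.exp (-(1 / (2 * τ ^ 2)) * t ^ 2)) *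
        ((Real.exp (-(β * |y|)) : ℂ) * Complex.exp (Complex.I * y * t)) := by
      intro y
      simp only [F]
      have : Complex.I * ((y - x : ℝ) : ℂ) * t = -(Complex.I * x * t) + Complex.I * y * t := by
        push_cast; ring
      rw [this, Complex.exp_add]; ring
    simp_rw [e1]
    rw [integral_const_mul, (integral_two_sided_exp hβ t).2]
    have e2 : g β τ t = E * Real.exp (-(1 / (2 * τ ^ 2)) * t ^ 2)
        * (1 / Real.pi * (β / (β ^ 2 + t ^ 2))) := by
      unfold g
      rw [mul_comm, ← Real.exp_add]
      congr 2; field_simp; ring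
    rw [e2]
    push_cast
    field_simp
  have hF : Integrable (Function.uncurry F) (volume.prod volume) := by
    have a1 : Integrable (fun y : ℝ => (Real.exp (-(β * |y|)) : ℂ)) := by
      have := (integral_two_sided_exp hβ 0).1
      simpa using this
    have a2 : Integrable (fun t : ℝ => (Real.exp (-(1 / (2 * τ ^ 2)) * t ^ 2) : ℂ)) :=
      (integrable_exp_neg_mul_sq (b := 1 / (2 * τ ^ 2)) (by positivity)).ofReal
    refine (a2.mul_prod a1).mono ?_ (ae_of_all _ ?_)
    · refine Continuous.aestronglyMeasurable ?_
      simp only [F, Function.uncurry_def]; fun_prop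
    · rintro ⟨t, y⟩
      simp only [F, Function.uncurry_apply_pair, norm_mul]
      have : ‖Complex.exp (Complex.I * (y - x : ℝ) * t)‖ = 1 := by
        rw [mul_assoc, mul_comm, ← Complex.ofReal_mul, Complex.norm_exp_ofReal_mul_I]
      rw [this, one_mul, mul_comm]
  simp_rw [h1]
  rw [integral_const_mul, integral_integral_swap hF]
  simp only [F]
  simp_rw [integral_const_mul, integral_gaussian_fourier hτ, ← Complex.ofReal_mul]
  rw [integral_complex_ofReal]
  simp_rw [mul_left_comm _ (2 * Real.pi), integral_const_mul]
  push_cast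
  field_simp

/-- A Chernoff bound. The integrands with `|y|` and with `y` agree for `y ≥ 0`; for `y < 0` their
difference is at most `exp (-β y)`, which `hx` bounds by `exp (-τ² x y)`. The Gaussian mean of the
latter is `exp (-τ² x² / 2)`. -/
theorem norm_fourier_g_sub_exp_le {β τ x : ℝ} (hβ : 0 < β) (hτ : 0 < τ) (hx : β ≤ τ ^ 2 * x) :
    ‖(∫ t : ℝ, (g β τ t : ℂ) * Complex.exp (-(Complex.I * x * t))) - Real.exp (-(β * x))‖
      ≤ Real.exp (-(τ ^ 2 * x ^ 2 / 2)) := by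
  rw [fourier_g hβ hτ, ← Complex.ofReal_sub, Complex.norm_real]
  have hi1 := integrable_exp_mul_gauss hτ β x
  have hle : ∀ y : ℝ, |Real.exp (-(β * |y|)) * gauss τ x y - Real.exp (-(β * y)) * gauss τ x y|
      ≤ Real.exp (-(τ ^ 2 * x * y)) * gauss τ x y := by
    intro y
    rw [← sub_mul, abs_mul, abs_of_nonneg (gauss_nonneg hτ x y)]
    refine mul_le_mul_of_nonneg_right ?_ (gauss_nonneg hτ x y)
    rcases le_or_gt 0 y with hy | hy
    · rw [abs_of_nonneg hy, sub_self, abs_zero]; positivity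
    · rw [abs_of_neg hy]
      have h1 : Real.exp (-(β * -y)) ≤ Real.exp (-(β * y)) := Real.exp_le_exp.2 (by nlinarith)
      have h2 : Real.exp (-(β * y)) ≤ Real.exp (-(τ ^ 2 * x * y)) :=
        Real.exp_le_exp.2 (by nlinarith)
      rw [abs_of_nonpos (by linarith)]
      have := Real.exp_pos (-(β * -y))
      linarith
  have hi2 : Integrable fun y => Real.exp (-(β * |y|)) * gauss τ x y := by
    refine (integrable_gauss hτ x).mono ?_ (ae_of_all _ fun y => ?_)
    · refine Continuous.aestronglyMeasurable ?_
      unfold gauss; fun_prop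
    · rw [norm_mul]
      refine mul_le_of_le_one_left (norm_nonneg _) ?_
      rw [Real.norm_of_nonneg (Real.exp_pos _).le, Real.exp_le_one_iff, neg_nonpos]
      positivity
  set E : ℝ := Real.exp (-(β ^ 2 / (2 * τ ^ 2))) with hE
  -- Without the absolute value the convolution formula is exact: the prefactor `E` cancels the
  -- variance term of the Gaussian moment generating function.
  have h3 : Real.exp (-(β * x)) = E * ∫ y, Real.exp (-(β * y)) * gauss τ x y := by
    rw [integral_exp_mul_gauss hτ, hE, ← Real.exp_add]; congr 1; ring
  rw [h3, ← mul_sub, ← integral_sub hi2 hi1, norm_mul, Real.norm_of_nonneg (Real.exp_pos _).le]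
  have hE1 : E ≤ 1 := by
    rw [hE, Real.exp_le_one_iff, neg_nonpos]; positivity
  refine (mul_le_of_le_one_left (norm_nonneg _) hE1).trans ?_
  refine (norm_integral_le_of_norm_le (integrable_exp_mul_gauss hτ (τ ^ 2 * x) x)
    (ae_of_all _ fun y => ?_)).trans ?_
  · exact hle y
  · rw [integral_exp_mul_gauss hτ]
    refine Real.exp_le_exp.2 (le_of_eq ?_)
    field_simp; ring

theorem integral_g_le_one {β : ℝ} (hβ : 0 < β) (τ : ℝ) (s : Set ℝ) :
    ∫ t in s, g β τ t ≤ 1 := by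
  rw [← integral_lorentz hβ]
  refine (setIntegral_le_integral (integrable_g hβ τ) (ae_of_all _ (g_nonneg hβ τ))).trans ?_
  exact integral_mono (integrable_g hβ τ) (integrable_lorentz hβ) (g_le_lorentz hβ τ)

/-- Outside `[-T, T]` the Gaussian factor is at most `exp (-T² / (2 τ²))`, while the Lorentzian has
total mass one. -/
theorem norm_setIntegral_g_tail_le {β τ T x : ℝ} (hβ : 0 < β) (hT : 0 < T) :
    ‖(∫ t : ℝ, (g β τ t : ℂ) * Complex.exp (-(Complex.I * x * t)))
      - ∫ t in Set.Icc (-T) T, (g β τ t : ℂ) * Complex.exp (-(Complex.I * x * t))‖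
      ≤ Real.exp (-(T ^ 2 / (2 * τ ^ 2))) := by
  have hn : ∀ t : ℝ, ‖(g β τ t : ℂ) * Complex.exp (-(Complex.I * x * t))‖ = g β τ t := by
    intro t
    have : -(Complex.I * x * t) = ((-(x * t) : ℝ) : ℂ) * Complex.I := by push_cast; ring
    rw [norm_mul, this, Complex.norm_exp_ofReal_mul_I, mul_one, Complex.norm_real,
      Real.norm_of_nonneg (g_nonneg hβ τ t)]
  have hc : Continuous fun t : ℝ => (g β τ t : ℂ) * Complex.exp (-(Complex.I * x * t)) := by
    have := continuous_g hβ τ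
    fun_prop
  have hi : Integrable fun t : ℝ => (g β τ t : ℂ) * Complex.exp (-(Complex.I * x * t)) :=
    (integrable_g hβ τ).mono hc.aestronglyMeasurable (ae_of_all _ fun t => by
      rw [hn, Real.norm_of_nonneg (g_nonneg hβ τ t)])
  rw [← integral_add_compl (measurableSet_Icc (a := -T) (b := T)) hi, add_sub_cancel_left]
  set e : ℝ := Real.exp (-(T ^ 2 / (2 * τ ^ 2)))
  have hb : ∫ t in (Set.Icc (-T) T)ᶜ, lorentz β t * e ≤ e := by
    rw [integral_mul_const]
    refine mul_le_of_le_one_left (Real.exp_pos _).le ?_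
    rw [← integral_lorentz hβ]
    exact setIntegral_le_integral (integrable_lorentz hβ) (ae_of_all _ (lorentz_nonneg hβ))
  refine (norm_integral_le_of_norm_le ((integrable_lorentz hβ).mul_const e).integrableOn
    ((ae_restrict_mem measurableSet_Icc.compl).mono fun t ht => ?_)).trans hb
  rw [hn, g_eq_lorentz_mul]
  refine mul_le_mul_of_nonneg_left (Real.exp_le_exp.2 ?_) (lorentz_nonneg hβ t)
  have ht2 : T ^ 2 ≤ β ^ 2 + t ^ 2 := by
    have : T < |t| := by
      by_contra h
      exact ht (abs_le.1 (not_lt.1 h))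
    have := sq_lt_sq' (by linarith [abs_nonneg t]) this
    rw [sq_abs] at this
    nlinarith [sq_nonneg β]
  gcongr

/-! ### Sums over sequences of labels -/

section SeqSum

variable {L R : Type*} [NormedRing R] [CompleteSpace R]

theorem reverse_ofFn_succ_prod {M : Type*} [Monoid M] {N : ℕ} (F : Fin (N + 1) → M) :
    (List.ofFn F).reverse.prod = (List.ofFn fun i : Fin N => F i.succ).reverse.prod * F 0 := by
  rw [List.ofFn_succ]; simp

/-- Noncommutative expansion of the power of a series. Absolute summability is carried along because
multiplying two series termwise requires it. The list is reversed since the first step acts first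
and so stands rightmost. -/
theorem summable_and_hasSum_reverse_ofFn_prod (f : L → R) (hf : Summable fun s => ‖f s‖) (N : ℕ) :
    Summable (fun S : Fin N → L => ‖(List.ofFn fun l => f (S l)).reverse.prod‖) ∧
    HasSum (fun S : Fin N → L => (List.ofFn fun l => f (S l)).reverse.prod) ((∑' s, f s) ^ N) := by
  induction N with
  | zero =>
    refine ⟨(hasSum_fintype _).summable, ?_⟩
    simp
  | succ N ih =>
    let e : (L × (Fin N → L)) ≃ (Fin (N + 1) → L) := Fin.consEquiv fun _ => L
    have he : ∀ z, (List.ofFn fun l => f (e z l)).reverse.prod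
        = (List.ofFn fun l => f (z.2 l)).reverse.prod * f z.1 := by
      rintro ⟨s, S⟩
      rw [reverse_ofFn_succ_prod]
      simp [e, Fin.consEquiv]
    have hs : Summable (fun z : L × (Fin N → L) =>
        ‖(List.ofFn fun l => f (z.2 l)).reverse.prod * f z.1‖) := by
      have := (ih.1.mul_norm hf).prod_symm
      exact this
    constructor
    · rw [← e.summable_iff]
      refine hs.congr fun z => ?_
      rw [Function.comp_apply, he]
    · rw [← e.hasSum_iff]
      have h1 : (∑' s, f s) ^ (N + 1)
          = ∑' z : (Fin N → L) × L, (List.ofFn fun l => f (z.1 l)).reverse.prod * f z.2 := by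
        rw [pow_succ, ← ih.2.tsum_eq, tsum_mul_tsum_of_summable_norm ih.1 hf]
      rw [h1, ← (Equiv.prodComm L (Fin N → L)).tsum_eq]
      have := hs.of_norm.hasSum
      exact this.congr_fun fun z => by rw [Function.comp_apply, he]

end SeqSum

/-! ### Pauli operators -/

theorem Pauli.mat_isHermitian (P : Pauli) : P.mat.IsHermitian := by
  cases P <;> ext i j <;> fin_cases i <;> fin_cases j <;> simp [Pauli.mat]

theorem Pauli.mat_mul_self (P : Pauli) : P.mat * P.mat = 1 := by
  cases P <;> ext i j <;> fin_cases i <;> fin_cases j <;>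
    simp [Pauli.mat, Matrix.mul_apply, Fin.sum_univ_two]

variable {n : ℕ}

theorem pauliString_isHermitian (P : Fin n → Pauli) : (pauliString P).IsHermitian := by
  ext x y
  simp only [pauliString, Matrix.conjTranspose_apply, Matrix.of_apply, star_prod]
  exact Finset.prod_congr rfl fun k _ => (P k).mat_isHermitian.apply _ _

/-- The sum over intermediate basis states factorises over the qubits, so the claim reduces to
single-qubit matrices. -/
theorem pauliString_mul_self (P : Fin n → Pauli) : pauliString P * pauliString P = 1 := by
  ext x z
  simp only [pauliString, Matrix.mul_apply, Matrix.of_apply, ← Finset.prod_mul_distrib]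
  have h := Finset.prod_univ_sum (fun _ : Fin n => (Finset.univ : Finset (Fin 2)))
    (fun k b => (P k).mat (x k) b * (P k).mat b (z k))
  rw [Fintype.piFinset_univ] at h
  rw [← h]
  simp_rw [← Matrix.mul_apply, Pauli.mat_mul_self, Matrix.one_apply]
  rw [Finset.prod_ite_zero]
  simp [funext_iff]

/-- The exponential of a multiple of an involution. -/
theorem exp_smul_of_mul_self_eq_one {σ : Op n} (hσ : σ * σ = 1) (c : ℂ) :
    NormedSpace.exp (c • σ) = Complex.cosh c • (1 : Op n) + Complex.sinh c • σ := by
  open scoped Matrix.Norms.L2Operator in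
  have hpow : ∀ k, σ ^ (2 * k) = 1 := fun k => by rw [pow_mul, pow_two, hσ, one_pow]
  have he : HasSum (fun k : ℕ => (((2 * k).factorial : ℂ)⁻¹) • (c • σ) ^ (2 * k))
      (Complex.cosh c • (1 : Op n)) := by
    refine ((Complex.hasSum_cosh c).smul_const (1 : Op n)).congr_fun fun k => ?_
    rw [smul_pow, hpow, smul_smul, div_eq_inv_mul]
  have ho : HasSum (fun k : ℕ => (((2 * k + 1).factorial : ℂ)⁻¹) • (c • σ) ^ (2 * k + 1))
      (Complex.sinh c • σ) := by
    refine ((Complex.hasSum_sinh c).smul_const σ).congr_fun fun k => ?_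
    rw [smul_pow, pow_succ σ, hpow, one_mul, smul_smul, div_eq_inv_mul]
  have h := HasSum.even_add_odd (f := fun k : ℕ => ((k.factorial : ℂ)⁻¹) • (c • σ) ^ k) he ho
  exact (NormedSpace.exp_series_hasSum_exp' (𝕂 := ℂ) (c • σ)).unique h

/-! ### The zeroth-order LOR formula -/

namespace PauliHamiltonian

variable (H : PauliHamiltonian n) (t : ℝ)

theorem sigma_isHermitian (j : Fin H.M) : (H.sigma j).IsHermitian := pauliString_isHermitian _

theorem sigma_mul_self (j : Fin H.M) : H.sigma j * H.sigma j = 1 := pauliString_mul_self _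

theorem sigma_mem_unitaryGroup (j : Fin H.M) : H.sigma j ∈ Matrix.unitaryGroup (Qubits n) ℂ := by
  rw [Matrix.mem_unitaryGroup_iff, Matrix.star_eq_conjTranspose, (H.sigma_isHermitian j).eq,
    H.sigma_mul_self]

theorem toOp_isHermitian : H.toOp.IsHermitian := by
  unfold toOp Matrix.IsHermitian
  rw [Matrix.conjTranspose_sum]
  refine Finset.sum_congr rfl fun j _ => ?_
  rw [Matrix.conjTranspose_smul, (H.sigma_isHermitian j).eq]
  simp

theorem hTot_nonneg : 0 ≤ H.hTot := Finset.sum_nonneg fun _ _ => abs_nonneg _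

theorem sin_phi : Real.sin (H.phi t) = H.hTot * |t| / √(1 + (H.hTot * |t|) ^ 2) :=
  Real.sin_arctan _

theorem cos_phi : Real.cos (H.phi t) = 1 / √(1 + (H.hTot * |t|) ^ 2) :=
  Real.cos_arctan _

theorem sin_phi_nonneg : 0 ≤ Real.sin (H.phi t) := by
  rw [sin_phi]; have := H.hTot_nonneg; positivity

theorem lorU_inl (j : Fin H.M) :
    H.lorU t (.inl j) = (Real.cos (Real.sign (H.h j * t) * H.phi t) : ℂ) • (1 : Op n)
      - (Complex.I * Real.sin (Real.sign (H.h j * t) * H.phi t) : ℂ) • H.sigma j := by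
  change NormedSpace.exp ((-(Complex.I * (Real.sign (H.h j * t) : ℂ) * (H.phi t : ℂ))) • H.sigma j)
    = _
  rw [exp_smul_of_mul_self_eq_one (H.sigma_mul_self j)]
  have : -(Complex.I * (Real.sign (H.h j * t) : ℂ) * (H.phi t : ℂ))
      = -(((Real.sign (H.h j * t) * H.phi t : ℝ) : ℂ) * Complex.I) := by push_cast; ring
  rw [this, Complex.cosh_neg, Complex.sinh_neg, Complex.cosh_mul_I, Complex.sinh_mul_I,
    Complex.ofReal_cos, Complex.ofReal_sin, neg_smul, sub_eq_add_neg, mul_comm Complex.I]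

theorem lorU_mem_unitaryGroup (s : LORLabel H.M) :
    H.lorU t s ∈ Matrix.unitaryGroup (Qubits n) ℂ := by
  rcases s with j | ⟨k, J⟩
  · rw [lorU_inl, Matrix.mem_unitaryGroup_iff, Matrix.star_eq_conjTranspose]
    generalize Real.sign (H.h j * t) * H.phi t = θ
    have h1 := H.sigma_mul_self j
    have h2 : ((Real.cos θ : ℂ)) ^ 2 + (Real.sin θ : ℂ) ^ 2 = 1 := by
      exact_mod_cast Real.cos_sq_add_sin_sq θ
    simp only [Matrix.conjTranspose_sub, Matrix.conjTranspose_smul, Matrix.conjTranspose_one,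
      (H.sigma_isHermitian j).eq, RCLike.star_def, Complex.conj_ofReal, map_mul, Complex.conj_I]
    generalize (Real.cos θ : ℂ) = c at h2 ⊢
    generalize (Real.sin θ : ℂ) = d at h2 ⊢
    have h3 : (c • (1 : Op n) - (Complex.I * d) • H.sigma j)
        * (c • (1 : Op n) - (-Complex.I * d) • H.sigma j)
        = (c ^ 2 - Complex.I ^ 2 * d ^ 2) • (1 : Op n) := by
      simp only [sub_mul, mul_sub, smul_mul_assoc, mul_smul_comm, one_mul, mul_one, h1]
      module
    rw [h3, Complex.I_sq, neg_one_mul, sub_neg_eq_add, h2, one_smul]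
  · refine Submonoid.list_prod_mem _ fun U hU => ?_
    rw [List.mem_reverse, List.mem_ofFn] at hU
    obtain ⟨a, rfl⟩ := hU
    exact H.sigma_mem_unitaryGroup _

theorem seqU_mem_unitaryGroup {N : ℕ} (S : Fin N → LORLabel H.M) :
    H.seqU t S ∈ Matrix.unitaryGroup (Qubits n) ℂ := by
  refine Submonoid.list_prod_mem _ fun U hU => ?_
  rw [List.mem_reverse, List.mem_ofFn] at hU
  obtain ⟨a, rfl⟩ := hU
  exact H.lorU_mem_unitaryGroup _ _

theorem lorWeight_inl (j : Fin H.M) :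
    H.lorWeight t (.inl j) = |H.h j| * |t| / Real.sin (H.phi t) := by
  simp only [lorWeight, lorCoeff, Complex.norm_real]
  rw [Real.norm_of_nonneg (div_nonneg (abs_nonneg _) (H.sin_phi_nonneg t)), abs_mul]

theorem lorWeight_inr (k : ℕ) (J : Fin (k + 2) → Fin H.M) :
    H.lorWeight t (.inr ⟨k, J⟩) = ((k + 2).factorial : ℝ)⁻¹ * ∏ a, (|H.h (J a)| * |t|) := by
  simp only [lorWeight, lorCoeff]
  simp

theorem lorWeight_nonneg (s : LORLabel H.M) : 0 ≤ H.lorWeight t s := norm_nonneg _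

/-- The tuples of length `k` contribute `x ^ k / k!`, that is, the exponential series from order two
on. At `t = 0` the rotation part is `0 / 0 = 0`, so there `C_A` is `0` and not its limit `1`. -/
theorem hasSum_lorWeight :
    HasSum (H.lorWeight t) (H.hTot * |t| / Real.sin (H.phi t)
      + (Real.exp (H.hTot * |t|) - 1 - H.hTot * |t|)) := by
  set x := H.hTot * |t| with hx
  have h1 : HasSum (fun j => H.lorWeight t (.inl j)) (x / Real.sin (H.phi t)) := by
    simp_rw [lorWeight_inl, hx, hTot, Finset.sum_mul, Finset.sum_div]
    exact hasSum_fintype _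
  have h2 : ∀ k, HasSum (fun J => H.lorWeight t (.inr ⟨k, J⟩))
      (((k + 2).factorial : ℝ)⁻¹ * x ^ (k + 2)) := by
    intro k
    simp_rw [lorWeight_inr, hx, hTot, Finset.sum_mul, Fintype.sum_pow, Finset.mul_sum]
    exact hasSum_fintype _
  have h3 : HasSum (fun k : ℕ => ((k + 2).factorial : ℝ)⁻¹ * x ^ (k + 2))
      (Real.exp x - 1 - x) := by
    have := NormedSpace.exp_series_hasSum_exp' (𝕂 := ℝ) x
    rw [← Real.exp_eq_exp_ℝ] at this
    rw [hasSum_nat_add_iff (f := fun k : ℕ => (k.factorial : ℝ)⁻¹ * x ^ k)]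
    simpa [Finset.sum_range_succ] using this
  have h4 : HasSum (fun z : Σ k : ℕ, (Fin (k + 2) → Fin H.M) => H.lorWeight t (.inr z))
      (Real.exp x - 1 - x) := by
    refine HasSum.sigma_of_hasSum h3 h2 ?_
    rw [summable_sigma_of_nonneg fun z => H.lorWeight_nonneg t (.inr z)]
    exact ⟨fun k => (h2 k).summable, h3.summable.congr fun k => ((h2 k).tsum_eq).symm⟩
  exact HasSum.sum (f := H.lorWeight t) h1 h4

theorem summable_lorWeight : Summable (H.lorWeight t) := (H.hasSum_lorWeight t).summable

theorem CA_eq : H.CA t = H.hTot * |t| / Real.sin (H.phi t)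
      + (Real.exp (H.hTot * |t|) - 1 - H.hTot * |t|) := (H.hasSum_lorWeight t).tsum_eq

theorem CA_nonneg : 0 ≤ H.CA t := tsum_nonneg (H.lorWeight_nonneg t)

theorem CA_eq_sqrt (hH : 0 < H.hTot) {t : ℝ} (ht : t ≠ 0) :
    H.CA t = √(1 + (H.hTot * |t|) ^ 2) + (Real.exp (H.hTot * |t|) - 1 - H.hTot * |t|) := by
  have hx : 0 < H.hTot * |t| := mul_pos hH (abs_pos.2 ht)
  rw [CA_eq, sin_phi]
  congr 1
  field_simp

/-- With `x = h_tot |t|` the rotations cost `√(1 + x²) ≤ 1 + x² / 2` and the tuples cost at most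
`x²`. Merging the identity with the first-order terms into rotations is what removes the linear term
in `x`. -/
theorem CA_le_exp_sq {t : ℝ} (ht : H.hTot * |t| ≤ 1) :
    H.CA t ≤ Real.exp (3 / 2 * (H.hTot * |t|) ^ 2) := by
  have h0 : 0 ≤ H.hTot * |t| := mul_nonneg H.hTot_nonneg (abs_nonneg t)
  rw [CA_eq, sin_phi]
  set x := H.hTot * |t|
  have h1 : x / (x / √(1 + x ^ 2)) ≤ 1 + x ^ 2 / 2 := by
    rcases h0.eq_or_lt with h | h
    · rw [← h]; simp
    · have : x / (x / √(1 + x ^ 2)) = √(1 + x ^ 2) := by field_simp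
      rw [this]
      apply Real.sqrt_le_iff.2
      constructor
      · positivity
      · nlinarith [sq_nonneg (x ^ 2)]
  have h2 : Real.exp x - 1 - x ≤ x ^ 2 := by
    have := Real.abs_exp_sub_one_sub_id_le (x := x) (by rwa [abs_of_nonneg h0])
    exact (le_abs_self _).trans this
  have h3 := Real.add_one_le_exp (3 / 2 * x ^ 2)
  linarith

/-- Since `tan φ = h_tot |t|`, rotation `j` carries the share `|h_j| / h_tot` of the identity
together with exactly its own first-order Taylor term. Summed over `j` these shares give `1`. -/
theorem lorCoeff_smul_lorU_inl (hH : 0 < H.hTot) {t : ℝ} (ht : t ≠ 0) (j : Fin H.M) :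
    H.lorCoeff t (.inl j) • H.lorU t (.inl j)
      = ((|H.h j| / H.hTot : ℝ) : ℂ) • (1 : Op n) + (-(Complex.I * H.h j * t)) • H.sigma j := by
  have hx : 0 < H.hTot * |t| := mul_pos hH (abs_pos.2 ht)
  have hs : 0 < Real.sin (H.phi t) := by rw [sin_phi]; positivity
  have hcs : |H.h j * t| / Real.sin (H.phi t) * Real.cos (H.phi t) = |H.h j| / H.hTot := by
    rw [sin_phi, cos_phi, abs_mul]
    have := abs_pos.2 ht
    field_simp
  rw [lorU_inl, smul_sub, smul_smul, smul_smul, sub_eq_add_neg, ← neg_smul]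
  have key : |H.h j * t| / Real.sin (H.phi t) * Real.cos (Real.sign (H.h j * t) * H.phi t)
        = |H.h j| / H.hTot ∧
      |H.h j * t| / Real.sin (H.phi t) * Real.sin (Real.sign (H.h j * t) * H.phi t)
        = H.h j * t := by
    rcases lt_trichotomy (H.h j * t) 0 with h | h | h
    · rw [Real.sign_of_neg h, neg_one_mul, Real.cos_neg, Real.sin_neg, hcs, abs_of_neg h]
      refine ⟨rfl, ?_⟩
      field_simp
    · have h0 : H.h j = 0 := (mul_eq_zero.1 h).resolve_right ht
      simp [h0]
    · rw [Real.sign_of_pos h, one_mul, hcs, abs_of_pos h]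
      refine ⟨rfl, ?_⟩
      field_simp
  simp only [lorCoeff]
  congr 1
  · rw [← Complex.ofReal_mul, key.1]
  · congr 2
    rw [mul_left_comm, ← Complex.ofReal_mul, key.2]
    push_cast; ring

theorem reverse_ofFn_smul_prod {N : ℕ} (c : Fin N → ℂ) (X : Fin N → Op n) :
    (List.ofFn fun a => c a • X a).reverse.prod = (∏ a, c a) • (List.ofFn X).reverse.prod := by
  induction N with
  | zero => simp
  | succ N ih =>
    rw [reverse_ofFn_succ_prod, ih (fun i => c i.succ) fun i => X i.succ,
      reverse_ofFn_succ_prod X, smul_mul_smul_comm, Fin.prod_univ_succ, mul_comm (c 0)]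

open scoped Matrix.Norms.L2Operator in
theorem norm_smul_le_of_mem_unitaryGroup {U : Op n} (hU : U ∈ Matrix.unitaryGroup (Qubits n) ℂ)
    (c : ℂ) : ‖c • U‖ ≤ ‖c‖ := by
  have : ‖U‖ = 1 := CStarRing.norm_of_mem_unitary hU
  rw [norm_smul, this, mul_one]

-- The rotations add up to the Taylor terms of order zero and one, and the tuples of length `k` to
-- the term of order `k`. Since the `U_s` are unitary, the weights dominate the series in norm.
open scoped Matrix.Norms.L2Operator in
theorem hasSum_lorCoeff_smul_lorU (hH : 0 < H.hTot) {t : ℝ} (ht : t ≠ 0) :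
    HasSum (fun s => H.lorCoeff t s • H.lorU t s)
      (NormedSpace.exp ((-(Complex.I * t)) • H.toOp)) := by
  set X : Op n := (-(Complex.I * t)) • H.toOp with hX
  have hXsum : X = ∑ j, (-(Complex.I * H.h j * t)) • H.sigma j := by
    rw [hX, toOp, Finset.smul_sum]
    refine Finset.sum_congr rfl fun j _ => ?_
    rw [smul_smul]; congr 1; ring
  have hsummable : Summable fun s => H.lorCoeff t s • H.lorU t s :=
    Summable.of_norm_bounded (H.summable_lorWeight t) fun s =>
      norm_smul_le_of_mem_unitaryGroup (H.lorU_mem_unitaryGroup t s) _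
  have h1 : HasSum (fun j => H.lorCoeff t (.inl j) • H.lorU t (.inl j)) (1 + X) := by
    have : 1 + X = ∑ j, H.lorCoeff t (.inl j) • H.lorU t (.inl j) := by
      simp_rw [H.lorCoeff_smul_lorU_inl hH ht]
      rw [Finset.sum_add_distrib, ← hXsum, ← Finset.sum_smul, ← Complex.ofReal_sum,
        ← Finset.sum_div, ← hTot, div_self hH.ne', Complex.ofReal_one, one_smul]
    rw [this]
    exact hasSum_fintype _
  have h2 : ∀ k, HasSum (fun J => H.lorCoeff t (.inr ⟨k, J⟩) • H.lorU t (.inr ⟨k, J⟩))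
      (((k + 2).factorial : ℂ)⁻¹ • X ^ (k + 2)) := by
    intro k
    have := (summable_and_hasSum_reverse_ofFn_prod
      (fun j => (-(Complex.I * H.h j * t)) • H.sigma j) (hasSum_fintype _).summable (k + 2)).2
    rw [tsum_fintype, ← hXsum] at this
    refine (this.const_smul (((k + 2).factorial : ℂ)⁻¹)).congr_fun fun J => ?_
    rw [reverse_ofFn_smul_prod, smul_smul]
    simp only [lorCoeff, lorU, one_div]
  have h3 : HasSum (fun k : ℕ => ((k + 2).factorial : ℂ)⁻¹ • X ^ (k + 2))
      (NormedSpace.exp X - 1 - X) := by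
    have := NormedSpace.exp_series_hasSum_exp' (𝕂 := ℂ) X
    rw [hasSum_nat_add_iff (f := fun k : ℕ => (k.factorial : ℂ)⁻¹ • X ^ k)]
    simpa [Finset.sum_range_succ] using this
  have h4 : HasSum (fun z : Σ k : ℕ, (Fin (k + 2) → Fin H.M) =>
      H.lorCoeff t (.inr z) • H.lorU t (.inr z)) (NormedSpace.exp X - 1 - X) :=
    HasSum.sigma_of_hasSum h3 h2 (hsummable.comp_injective Sum.inr_injective)
  have := HasSum.sum (f := fun s => H.lorCoeff t s • H.lorU t s) h1 h4
  rwa [show 1 + X + (NormedSpace.exp X - 1 - X) = NormedSpace.exp X by abel] at this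

/-- The coefficient `w_𝐒(t) exp (i θ_𝐒(t))` of `U_𝐒(t)`. -/
noncomputable def seqCoeff {N : ℕ} (t : ℝ) (S : Fin N → LORLabel H.M) : ℂ :=
  ∏ l, H.lorCoeff (t / N) (S l)

theorem seqCoeff_eq {N : ℕ} (S : Fin N → LORLabel H.M) :
    H.seqCoeff t S = H.seqWeight t S * Complex.exp (Complex.I * H.seqTheta t S) := by
  unfold seqCoeff seqWeight seqTheta
  push_cast
  rw [Finset.mul_sum, Complex.exp_sum, ← Finset.prod_mul_distrib]
  refine Finset.prod_congr rfl fun l _ => ?_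
  rw [mul_comm Complex.I]
  exact (Complex.norm_mul_exp_arg_mul_I _).symm

theorem norm_seqCoeff {N : ℕ} (S : Fin N → LORLabel H.M) :
    ‖H.seqCoeff t S‖ = H.seqWeight t S := by
  unfold seqCoeff seqWeight; rw [norm_prod]; rfl

theorem seqWeight_nonneg {N : ℕ} (S : Fin N → LORLabel H.M) : 0 ≤ H.seqWeight t S :=
  Finset.prod_nonneg fun _ _ => H.lorWeight_nonneg _ _

theorem hasSum_seqWeight (N : ℕ) :
    HasSum (fun S : Fin N → LORLabel H.M => H.seqWeight t S) (H.CA (t / N) ^ N) := by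
  have := (summable_and_hasSum_reverse_ofFn_prod (H.lorWeight (t / N))
    (by simpa only [Real.norm_of_nonneg (H.lorWeight_nonneg _ _)]
          using H.summable_lorWeight (t / N)) N).2
  refine this.congr_fun fun S => ?_
  rw [List.prod_reverse, List.prod_ofFn]
  rfl

-- There is no Trotter error: each step is an exact expansion of the evolution over `t / N`, and
-- these evolutions are powers of one exponential.
open scoped Matrix.Norms.L2Operator in
theorem hasSum_seqCoeff_smul_seqU (hH : 0 < H.hTot) {t : ℝ} (ht : t ≠ 0) {N : ℕ} (hN : N ≠ 0) :
    HasSum (fun S : Fin N → LORLabel H.M => H.seqCoeff t S • H.seqU t S)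
      (NormedSpace.exp ((-(Complex.I * t)) • H.toOp)) := by
  have ht' : t / N ≠ 0 := div_ne_zero ht (Nat.cast_ne_zero.2 hN)
  have h := (summable_and_hasSum_reverse_ofFn_prod
    (fun s => H.lorCoeff (t / N) s • H.lorU (t / N) s)
    (Summable.of_nonneg_of_le (fun _ => norm_nonneg _) (fun s =>
      norm_smul_le_of_mem_unitaryGroup (H.lorU_mem_unitaryGroup (t / N) s) _)
      (H.summable_lorWeight (t / N))) N).2
  rw [(H.hasSum_lorCoeff_smul_lorU hH ht').tsum_eq, ← Matrix.exp_nsmul] at h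
  have e : N • ((-(Complex.I * ((t / N : ℝ) : ℂ))) • H.toOp) = (-(Complex.I * t)) • H.toOp := by
    rw [← Nat.cast_smul_eq_nsmul ℂ, smul_smul]
    congr 1
    have : (N : ℂ) ≠ 0 := Nat.cast_ne_zero.2 hN
    push_cast; field_simp
  rw [e] at h
  refine h.congr_fun fun S => ?_
  rw [reverse_ofFn_smul_prod]
  rfl

/-! ### Measurability in time -/

theorem measurable_phi : Measurable H.phi := by
  unfold phi; fun_prop

theorem measurable_lorCoeff (s : LORLabel H.M) : Measurable fun t => H.lorCoeff t s := by
  have := H.measurable_phi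
  rcases s with j | ⟨k, J⟩
  · simp only [lorCoeff]; fun_prop
  · simp only [lorCoeff]; fun_prop

theorem measurable_sign : Measurable Real.sign := by
  unfold Real.sign
  exact Measurable.ite measurableSet_Iio measurable_const
    (Measurable.ite measurableSet_Ioi measurable_const measurable_const)

theorem measurable_lorU (s : LORLabel H.M) (x y : Qubits n) :
    Measurable fun t => H.lorU t s x y := by
  rcases s with j | ⟨k, J⟩
  · have h1 := H.measurable_phi
    have h2 := measurable_sign
    have h3 : Measurable fun t => Real.sign (H.h j * t) * H.phi t :=
      (h2.comp (measurable_const_mul _)).mul h1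
    simp_rw [lorU_inl, Matrix.sub_apply, Matrix.smul_apply, smul_eq_mul]
    fun_prop
  · exact measurable_const

theorem measurable_seqCoeff {N : ℕ} (S : Fin N → LORLabel H.M) :
    Measurable fun t => H.seqCoeff t S := by
  unfold seqCoeff
  exact Finset.measurable_fun_prod _ fun l _ =>
    (H.measurable_lorCoeff _).comp (measurable_id.div_const _)

theorem measurable_reverse_ofFn_prod {N : ℕ} (X : Fin N → ℝ → Op n)
    (hX : ∀ l x y, Measurable fun t => X l t x y) (x y : Qubits n) :
    Measurable fun t => (List.ofFn fun l => X l t).reverse.prod x y := by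
  induction N generalizing x y with
  | zero => simp
  | succ N ih =>
    simp_rw [reverse_ofFn_succ_prod, Matrix.mul_apply]
    exact Finset.measurable_fun_sum _ fun z _ =>
      (ih (fun l => X l.succ) (fun l => hX l.succ) x z).mul (hX 0 z y)

theorem measurable_seqU {N : ℕ} (S : Fin N → LORLabel H.M) (x y : Qubits n) :
    Measurable fun t => H.seqU t S x y :=
  measurable_reverse_ofFn_prod (fun l t => H.lorU (t / N) (S l))
    (fun l x y => (H.measurable_lorU (S l) x y).comp (measurable_id.div_const _)) x y

end PauliHamiltonian

/-! ### Inner products and norms of state vectors -/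

section Ket

variable {ι : Type} [Fintype ι]

/-- The Euclidean norm of a state vector. -/
noncomputable def ketNorm (u : ι → ℂ) : ℝ := ‖WithLp.toLp 2 u‖

theorem ketNorm_nonneg (u : ι → ℂ) : 0 ≤ ketNorm u := norm_nonneg _

theorem braket_eq_inner (u v : ι → ℂ) :
    braket u v = inner ℂ (WithLp.toLp 2 u) (WithLp.toLp 2 v) := by
  rw [EuclideanSpace.inner_eq_star_dotProduct, dotProduct_comm]; rfl

theorem norm_braket_le (u v : ι → ℂ) : ‖braket u v‖ ≤ ketNorm u * ketNorm v := by
  rw [braket_eq_inner]; exact norm_inner_le_norm _ _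

theorem braket_self (u : ι → ℂ) : braket u u = ((ketNorm u ^ 2 : ℝ) : ℂ) := by
  rw [braket_eq_inner, inner_self_eq_norm_sq_to_K]; norm_cast

theorem ketNorm_eq_one {u : ι → ℂ} (h : braket u u = 1) : ketNorm u = 1 := by
  rw [braket_self] at h
  exact (pow_eq_one_iff_of_nonneg (ketNorm_nonneg u) two_ne_zero).1 (by exact_mod_cast h)

theorem ketNorm_sq (u : ι → ℂ) : ketNorm u ^ 2 = ∑ i, ‖u i‖ ^ 2 :=
  EuclideanSpace.norm_sq_eq _

theorem norm_apply_le_ketNorm (u : ι → ℂ) (i : ι) : ‖u i‖ ≤ ketNorm u :=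
  PiLp.norm_apply_le (WithLp.toLp 2 u) i

theorem ketNorm_sub_le (u v : ι → ℂ) : ketNorm u ≤ ketNorm v + ketNorm (u - v) := by
  have := norm_add_le (WithLp.toLp 2 v) (WithLp.toLp 2 (u - v))
  rwa [← WithLp.toLp_add, add_sub_cancel] at this

theorem braket_conj_symm (u v : ι → ℂ) : star (braket u v) = braket v u := by
  rw [braket_eq_inner, braket_eq_inner]; exact inner_conj_symm _ _

theorem braket_sub_right (u v w : ι → ℂ) : braket u (v - w) = braket u v - braket u w :=
  dotProduct_sub _ _ _

theorem braket_sub_left (u v w : ι → ℂ) : braket (u - v) w = braket u w - braket v w := by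
  unfold braket; rw [star_sub, sub_dotProduct]

theorem braket_smul_right (c : ℂ) (u v : ι → ℂ) : braket u (c • v) = c * braket u v :=
  dotProduct_smul _ _ _

theorem braket_smul_left (c : ℂ) (u v : ι → ℂ) : braket (c • u) v = star c * braket u v := by
  unfold braket; rw [star_smul, smul_dotProduct, smul_eq_mul]

theorem braket_mulVec_left (A : Matrix ι ι ℂ) (u v : ι → ℂ) :
    braket (A *ᵥ u) v = braket u (Aᴴ *ᵥ v) := by
  unfold braket
  rw [Matrix.star_mulVec, Matrix.dotProduct_mulVec]

theorem braket_mulVec_eq_sum (A : Matrix ι ι ℂ) (u v : ι → ℂ) :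
    braket u (A *ᵥ v) = ∑ x, ∑ y, star (u x) * (A x y * v y) := by
  simp only [braket, dotProduct, Matrix.mulVec, Pi.star_apply, Finset.mul_sum]

variable [DecidableEq ι]

theorem braket_unitary_mulVec {U : Matrix ι ι ℂ} (hU : U ∈ Matrix.unitaryGroup ι ℂ) (u v : ι → ℂ) :
    braket (U *ᵥ u) (U *ᵥ v) = braket u v := by
  rw [braket_mulVec_left, Matrix.mulVec_mulVec, ← Matrix.star_eq_conjTranspose,
    Matrix.mem_unitaryGroup_iff'.1 hU, Matrix.one_mulVec]

theorem ketNorm_unitary_mulVec {U : Matrix ι ι ℂ} (hU : U ∈ Matrix.unitaryGroup ι ℂ) (u : ι → ℂ) :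
    ketNorm (U *ᵥ u) = ketNorm u := by
  have := braket_unitary_mulVec hU u u
  rw [braket_self, braket_self] at this
  exact (pow_left_inj₀ (ketNorm_nonneg _) (ketNorm_nonneg _) two_ne_zero).1 (by exact_mod_cast this)

end Ket

variable {n : ℕ}

theorem Observable.braket_toOp (O : Observable n) (u v : Ket n) :
    braket u (O.toOp *ᵥ v) = ∑ j, (O.a j : ℂ) * braket u (O.op j *ᵥ v) := by
  unfold Observable.toOp
  rw [Matrix.sum_mulVec]
  simp only [braket, dotProduct_sum, Matrix.smul_mulVec, dotProduct_smul, smul_eq_mul]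

theorem Observable.norm_braket_le (O : Observable n) (u v : Ket n) :
    ‖braket u (O.toOp *ᵥ v)‖ ≤ O.aTot * (ketNorm u * ketNorm v) := by
  rw [O.braket_toOp, aTot, Finset.sum_mul]
  refine norm_sum_le_of_le _ fun j _ => ?_
  rw [norm_mul, Complex.norm_real, Real.norm_eq_abs]
  refine mul_le_mul_of_nonneg_left ((ITS.norm_braket_le _ _).trans ?_) (abs_nonneg _)
  rw [ketNorm_unitary_mulVec (O.isUnitary j)]

theorem Observable.identity_toOp : (Observable.identity n).toOp = 1 := by
  change ∑ _j : Fin 1, ((1 : ℝ) : ℂ) • (1 : Op n) = 1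
  simp

theorem Observable.identity_aTot : (Observable.identity n).aTot = 1 := by
  change ∑ _j : Fin 1, |(1 : ℝ)| = 1
  simp

/-! ### The Hadamard test -/

theorem blockDiagonal_mulVec_apply {m o : Type*} [Fintype m] [Fintype o] [DecidableEq o]
    (M : o → Matrix m m ℂ) (v : m × o → ℂ) (i : m) (k : o) :
    (Matrix.blockDiagonal M *ᵥ v) (i, k) = (M k *ᵥ fun j => v (j, k)) i := by
  simp only [Matrix.mulVec, dotProduct, Fintype.sum_prod_type, Matrix.blockDiagonal_apply]
  refine Finset.sum_congr rfl fun j _ => ?_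
  simp

/-- The controlled gates are block diagonal in the ancillary index, so the final state is `(V'Ψ ⊗
|0⟩ + WVΨ ⊗ |1⟩) / √2`, read off block by block. -/
theorem hadamardState_apply_zero (V' W V : Op n) (Ψ : Ket n) (x : Qubits n) :
    hadamardState V' W V Ψ (x, 0) = (1 / √2 : ℝ) * (V' *ᵥ Ψ) x := by
  unfold hadamardState ctrl
  rw [← Matrix.mulVec_mulVec, ← Matrix.mulVec_mulVec]
  simp only [blockDiagonal_mulVec_apply]
  simp only [Matrix.one_mulVec, zero_ne_one, if_true, if_false]
  rw [show (fun j => Ψ j * ((1 / √2 : ℝ) : ℂ)) = ((1 / √2 : ℝ) : ℂ) • Ψ from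
    funext fun j => mul_comm _ _, Matrix.mulVec_smul]
  rfl

theorem hadamardState_apply_one (V' W V : Op n) (Ψ : Ket n) (x : Qubits n) :
    hadamardState V' W V Ψ (x, 1) = (1 / √2 : ℝ) * (W *ᵥ (V *ᵥ Ψ)) x := by
  unfold hadamardState ctrl
  rw [← Matrix.mulVec_mulVec, ← Matrix.mulVec_mulVec]
  simp only [blockDiagonal_mulVec_apply]
  simp only [Matrix.one_mulVec, one_ne_zero, if_true, if_false]
  rw [show (fun j => Ψ j * ((1 / √2 : ℝ) : ℂ)) = ((1 / √2 : ℝ) : ℂ) • Ψ from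
    funext fun j => mul_comm _ _, Matrix.mulVec_smul, Matrix.mulVec_smul]
  rfl

theorem one_kronecker_mulVec_apply (P : Matrix (Fin 2) (Fin 2) ℂ) (φ : Qubits n × Fin 2 → ℂ)
    (x : Qubits n) (i : Fin 2) :
    (((1 : Op n) ⊗ₖ P) *ᵥ φ) (x, i) = P i 0 * φ (x, 0) + P i 1 * φ (x, 1) := by
  simp only [Matrix.mulVec, dotProduct, Fintype.sum_prod_type, Matrix.kroneckerMap_apply,
    Matrix.one_apply, ite_mul, one_mul, zero_mul, Fin.sum_univ_two]
  rw [Finset.sum_eq_single x]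
  · simp
  · intro y _ hy
    simp [hy.symm]
  · simp

/-- The expected value of an ancillary observable in the state `(|u⟩|0⟩ + |w⟩|1⟩) / √2`. -/
theorem braket_one_kronecker (P : Matrix (Fin 2) (Fin 2) ℂ) (φ : Qubits n × Fin 2 → ℂ)
    (u w : Ket n) (h0 : ∀ x, φ (x, 0) = (1 / √2 : ℝ) * u x)
    (h1 : ∀ x, φ (x, 1) = (1 / √2 : ℝ) * w x) :
    braket φ (((1 : Op n) ⊗ₖ P) *ᵥ φ) = 1 / 2 * (P 0 0 * braket u u + P 0 1 * braket u w
      + P 1 0 * braket w u + P 1 1 * braket w w) := by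
  have hs : ((1 / √2 : ℝ) : ℂ) * ((1 / √2 : ℝ) : ℂ) = 1 / 2 := by
    rw [← Complex.ofReal_mul, div_mul_div_comm, Real.mul_self_sqrt (by norm_num)]
    norm_num
  generalize ((1 / √2 : ℝ)) = s at h0 h1 hs
  simp only [braket, dotProduct, Fintype.sum_prod_type, Fin.sum_univ_two,
    one_kronecker_mulVec_apply, Pi.star_apply, h0, h1, Finset.mul_sum, ← Finset.sum_add_distrib]
  refine Finset.sum_congr rfl fun x _ => ?_
  simp only [star_mul', RCLike.star_def, Complex.conj_ofReal]
  rw [← hs]; ring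

variable {V' W V : Op n} {Ψ : Ket n}

/-- The diagonal entries of the projector see only the norms of the two branches, which are one; the
off-diagonal entries see their overlap, whose real part `X` selects (and `Y` its imaginary part). -/
theorem ancillaProb_X (hV' : V' ∈ Matrix.unitaryGroup (Qubits n) ℂ)
    (hW : W ∈ Matrix.unitaryGroup (Qubits n) ℂ) (hV : V ∈ Matrix.unitaryGroup (Qubits n) ℂ)
    (hΨ : braket Ψ Ψ = 1) (b : Bool) :
    ancillaProb .X (hadamardState V' W V Ψ) b
      = (1 + outcome b * (braket (V' *ᵥ Ψ) (W *ᵥ (V *ᵥ Ψ))).re) / 2 := by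
  unfold ancillaProb
  rw [braket_one_kronecker _ _ _ _ (hadamardState_apply_zero V' W V Ψ)
    (hadamardState_apply_one V' W V Ψ), braket_unitary_mulVec hV', braket_unitary_mulVec hW,
    braket_unitary_mulVec hV, hΨ, ← braket_conj_symm (V' *ᵥ Ψ)]
  generalize braket (V' *ᵥ Ψ) (W *ᵥ (V *ᵥ Ψ)) = z
  simp [Pauli.mat]
  ring

theorem ancillaProb_Y (hV' : V' ∈ Matrix.unitaryGroup (Qubits n) ℂ)
    (hW : W ∈ Matrix.unitaryGroup (Qubits n) ℂ) (hV : V ∈ Matrix.unitaryGroup (Qubits n) ℂ)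
    (hΨ : braket Ψ Ψ = 1) (b : Bool) :
    ancillaProb .Y (hadamardState V' W V Ψ) b
      = (1 + outcome b * (braket (V' *ᵥ Ψ) (W *ᵥ (V *ᵥ Ψ))).im) / 2 := by
  unfold ancillaProb
  rw [braket_one_kronecker _ _ _ _ (hadamardState_apply_zero V' W V Ψ)
    (hadamardState_apply_one V' W V Ψ), braket_unitary_mulVec hV', braket_unitary_mulVec hW,
    braket_unitary_mulVec hV, hΨ, ← braket_conj_symm (V' *ᵥ Ψ)]
  generalize braket (V' *ᵥ Ψ) (W *ᵥ (V *ᵥ Ψ)) = z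
  simp [Pauli.mat]
  ring

theorem norm_braket_unitary_le (hV' : V' ∈ Matrix.unitaryGroup (Qubits n) ℂ)
    (hW : W ∈ Matrix.unitaryGroup (Qubits n) ℂ) (hV : V ∈ Matrix.unitaryGroup (Qubits n) ℂ)
    (hΨ : braket Ψ Ψ = 1) : ‖braket (V' *ᵥ Ψ) (W *ᵥ (V *ᵥ Ψ))‖ ≤ 1 := by
  refine (norm_braket_le _ _).trans ?_
  rw [ketNorm_unitary_mulVec hV', ketNorm_unitary_mulVec hW, ketNorm_unitary_mulVec hV,
    ketNorm_eq_one hΨ, one_mul]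

theorem one_add_outcome_mul_nonneg {x : ℝ} (hx : |x| ≤ 1) (b : Bool) :
    0 ≤ (1 + outcome b * x) / 2 := by
  have := abs_le.1 hx
  cases b <;> simp [outcome] <;> linarith

variable {n : ℕ} (H : PauliHamiltonian n)

/-! ### The normalisation `C_T` -/

namespace PauliHamiltonian

/-- Label sequences form a countable discrete space, so joint measurability reduces to measurability
in time for each fixed sequence. -/
theorem measurable_prod_seqCoeff (N : ℕ) :
    Measurable fun z : ℝ × (Fin N → LORLabel H.M) => H.seqCoeff z.1 z.2 :=
  measurable_from_prod_countable_left fun S => H.measurable_seqCoeff S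

theorem measurable_prod_seqWeight (N : ℕ) :
    Measurable fun z : ℝ × (Fin N → LORLabel H.M) => H.seqWeight z.1 z.2 := by
  simp_rw [← norm_seqCoeff]
  exact (H.measurable_prod_seqCoeff N).norm

theorem measurable_prod_seqTheta (N : ℕ) :
    Measurable fun z : ℝ × (Fin N → LORLabel H.M) => H.seqTheta z.1 z.2 := by
  refine measurable_from_prod_countable_left fun S => ?_
  unfold seqTheta lorTheta
  exact Finset.measurable_fun_sum _ fun l _ => Complex.measurable_arg.comp
    ((H.measurable_lorCoeff _).comp (measurable_id.div_const _))

theorem measurable_prod_seqU (N : ℕ) (x y : Qubits n) :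
    Measurable fun z : ℝ × (Fin N → LORLabel H.M) => H.seqU z.1 z.2 x y :=
  measurable_from_prod_countable_left fun S => H.measurable_seqU S x y

theorem measurable_prod_seqU_mulVec (N : ℕ) (Ψ : Ket n) (x : Qubits n) :
    Measurable fun z : ℝ × (Fin N → LORLabel H.M) => (H.seqU z.1 z.2 *ᵥ Ψ) x := by
  simp only [Matrix.mulVec, dotProduct]
  exact Finset.measurable_fun_sum _ fun y _ => (H.measurable_prod_seqU N x y).mul_const _

end PauliHamiltonian

/-- A continuous function that agrees with the integrand of `C_T` away from `t = 0`. -/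
noncomputable def CTIntegrand (β τ : ℝ) (N : ℕ) (t : ℝ) : ℝ :=
  g β τ t * (√(1 + (H.hTot * |t / N|) ^ 2)
    + (Real.exp (H.hTot * |t / N|) - 1 - H.hTot * |t / N|)) ^ N

theorem continuous_CTIntegrand {β : ℝ} (hβ : 0 < β) (τ : ℝ) (N : ℕ) :
    Continuous (CTIntegrand H β τ N) := by
  have := continuous_g hβ τ
  unfold CTIntegrand
  fun_prop

theorem CTIntegrand_pos {β : ℝ} (hβ : 0 < β) (τ : ℝ) (N : ℕ) (t : ℝ) :
    0 < CTIntegrand H β τ N t := by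
  refine mul_pos (g_pos hβ τ t) (pow_pos (add_pos_of_pos_of_nonneg ?_ ?_) _)
  · positivity
  · linarith [Real.add_one_le_exp (H.hTot * |t / N|)]

variable {H}

/-- Only `t = 0` is exceptional, because of the value of `C_A` there. -/
theorem ae_eq_CTIntegrand (hH : 0 < H.hTot) (β τ : ℝ) {N : ℕ} (hN : N ≠ 0) (μ : Measure ℝ)
    [NullSingletonClass μ] :
    (fun t => g β τ t * H.CA (t / N) ^ N) =ᵐ[μ] CTIntegrand H β τ N := by
  have h0 : ∀ᵐ t ∂μ, t ≠ 0 := compl_mem_ae_iff.2 (measure_singleton 0)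
  filter_upwards [h0] with t ht
  simp only [CTIntegrand]
  rw [H.CA_eq_sqrt hH (div_ne_zero ht (Nat.cast_ne_zero.2 hN))]

theorem integrableOn_g_mul_CA (hH : 0 < H.hTot) {β : ℝ} (hβ : 0 < β) (τ T : ℝ) {N : ℕ}
    (hN : N ≠ 0) : IntegrableOn (fun t => g β τ t * H.CA (t / N) ^ N) (Set.Icc (-T) T) :=
  (continuous_CTIntegrand H hβ τ N).integrableOn_Icc.congr
    (ae_eq_CTIntegrand hH β τ hN _).symm

variable {β : ℝ} {p : Params}

theorem CT_eq_setIntegral (hT : 0 < p.T) :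
    CT H β p = ∫ t in Set.Icc (-p.T) p.T, g β p.τ t * H.CA (t / p.Nt) ^ p.Nt := by
  unfold CT
  rw [intervalIntegral.integral_of_le (by linarith), integral_Icc_eq_integral_Ioc]

theorem CT_pos (hH : 0 < H.hTot) (hβ : 0 < β) (hT : 0 < p.T) (hN : p.Nt ≠ 0) : 0 < CT H β p := by
  rw [CT_eq_setIntegral hT, integral_congr_ae (ae_eq_CTIntegrand hH β p.τ hN _),
    integral_Icc_eq_integral_Ioc, ← intervalIntegral.integral_of_le (by linarith)]
  exact intervalIntegral.intervalIntegral_pos_of_pos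
    ((continuous_CTIntegrand H hβ p.τ p.Nt).intervalIntegrable _ _)
    (CTIntegrand_pos H hβ p.τ p.Nt) (by linarith)

/-- The excess of one step is quadratic in its length, so `N_t` steps accumulate the exponent `3/2
(h_tot t)² / N_t ≤ 3/2`, and `g` has mass at most one. The sampling overhead is thus bounded by a
universal constant. -/
theorem CT_le (hH : 0 < H.hTot) (hβ : 0 < β) (hT : 0 < p.T) (hN : 1 ≤ p.Nt)
    (hNT : (H.hTot * p.T) ^ 2 ≤ p.Nt) : CT H β p ≤ Real.exp (3 / 2) := by
  have hN1 : (1 : ℝ) ≤ p.Nt := by exact_mod_cast hN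
  have hN0 : p.Nt ≠ 0 := by omega
  rw [CT_eq_setIntegral hT]
  calc _ ≤ ∫ t in Set.Icc (-p.T) p.T, g β p.τ t * Real.exp (3 / 2) := by
        refine setIntegral_mono_on (integrableOn_g_mul_CA hH hβ p.τ p.T hN0)
          ((integrable_g hβ p.τ).mul_const _).integrableOn measurableSet_Icc fun t ht => ?_
        refine mul_le_mul_of_nonneg_left ?_ (g_nonneg hβ _ _)
        have h1 : H.hTot * |t| ≤ H.hTot * p.T :=
          mul_le_mul_of_nonneg_left (abs_le.2 ht) hH.le
        have h0 : 0 ≤ H.hTot * |t| := mul_nonneg hH.le (abs_nonneg _)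
        have h2 : (H.hTot * |t|) ^ 2 ≤ p.Nt := (pow_le_pow_left₀ h0 h1 2).trans hNT
        have h3 : H.hTot * |t / p.Nt| = H.hTot * |t| / p.Nt := by
          rw [abs_div, Nat.abs_cast, mul_div_assoc]
        -- From `x² ≤ N_t` and `1 ≤ N_t` follows `x ≤ N_t`.
        have h4 : H.hTot * |t / p.Nt| ≤ 1 := by
          rw [h3, div_le_one (by linarith)]
          nlinarith
        refine (pow_le_pow_left₀ (H.CA_nonneg _) (H.CA_le_exp_sq h4) _).trans ?_
        rw [← Real.exp_nat_mul, h3]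
        refine Real.exp_le_exp.2 ?_
        have h5 : (p.Nt : ℝ) * (3 / 2 * (H.hTot * |t| / p.Nt) ^ 2)
            = 3 / 2 * ((H.hTot * |t|) ^ 2 / p.Nt) := by
          field_simp
        rw [h5]
        have : (H.hTot * |t|) ^ 2 / p.Nt ≤ 1 := (div_le_one (by linarith)).2 h2
        linarith
    _ ≤ Real.exp (3 / 2) := by
        rw [integral_mul_const]
        exact mul_le_of_le_one_left (Real.exp_pos _).le (integral_g_le_one hβ _ _)

/-- The reference measure on pairs `(t, 𝐒)`. -/
noncomputable def pathMeasure (H : PauliHamiltonian n) (p : Params) :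
    Measure (ℝ × (Fin p.Nt → LORLabel H.M)) :=
  (volume.restrict (Set.Icc (-p.T) p.T)).prod Measure.count

instance : SFinite (pathMeasure H p) := by unfold pathMeasure; infer_instance

/-- The unnormalised density `g(t) w_𝐒(t)`. -/
noncomputable def pathWeight (H : PauliHamiltonian n) (β : ℝ) (p : Params)
    (z : ℝ × (Fin p.Nt → LORLabel H.M)) : ℝ :=
  g β p.τ z.1 * H.seqWeight z.1 z.2

theorem pathWeight_nonneg (hβ : 0 < β) (z : ℝ × (Fin p.Nt → LORLabel H.M)) :
    0 ≤ pathWeight H β p z := mul_nonneg (g_nonneg hβ _ _) (H.seqWeight_nonneg _ _)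

theorem measurable_pathWeight (hβ : 0 < β) : Measurable (pathWeight H β p) :=
  ((continuous_g hβ p.τ).measurable.comp measurable_fst).mul (H.measurable_prod_seqWeight p.Nt)

/-- Summing over the label sequences turns the weights into `C_A(t / N_t) ^ N_t`. So `C_T`
normalises one path, and `C_T ^ 2` the pair of paths in a sample. -/
theorem lintegral_pathWeight (hH : 0 < H.hTot) (hβ : 0 < β) (hT : 0 < p.T) (hN : p.Nt ≠ 0) :
    ∫⁻ z, ENNReal.ofReal (pathWeight H β p z) ∂(pathMeasure H p) = ENNReal.ofReal (CT H β p) := by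
  unfold pathMeasure
  rw [lintegral_prod _ (measurable_pathWeight hβ).ennreal_ofReal.aemeasurable,
    CT_eq_setIntegral hT, ofReal_integral_eq_lintegral_ofReal
      (integrableOn_g_mul_CA hH hβ p.τ p.T hN) (ae_of_all _ fun t =>
        mul_nonneg (g_nonneg hβ _ _) (pow_nonneg (H.CA_nonneg _) _))]
  refine lintegral_congr fun t => ?_
  have h := (H.hasSum_seqWeight t p.Nt).mul_left (g β p.τ t)
  rw [lintegral_count, ← h.tsum_eq, ENNReal.ofReal_tsum_of_nonneg
    (fun S => mul_nonneg (g_nonneg hβ _ _) (H.seqWeight_nonneg _ _)) h.summable]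
  rfl

theorem integrable_pathWeight (hH : 0 < H.hTot) (hβ : 0 < β) (hT : 0 < p.T) (hN : p.Nt ≠ 0) :
    Integrable (pathWeight H β p) (pathMeasure H p) := by
  refine ⟨(measurable_pathWeight hβ).aestronglyMeasurable, ?_⟩
  rw [hasFiniteIntegral_iff_ofReal (ae_of_all _ (pathWeight_nonneg hβ)),
    lintegral_pathWeight hH hβ hT hN]
  exact ENNReal.ofReal_lt_top

/-! ### The averaged path -/

/-- The contribution `g(t) e^{i E₀ t} w_𝐒(t) e^{i θ_𝐒(t)} U_𝐒(t)|Ψ⟩` of a path. -/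
noncomputable def pathKet (H : PauliHamiltonian n) (β : ℝ) (p : Params) (Ψ : Ket n)
    (z : ℝ × (Fin p.Nt → LORLabel H.M)) : Ket n :=
  ((g β p.τ z.1 : ℂ) * Complex.exp (Complex.I * p.E₀ * z.1) * H.seqCoeff z.1 z.2) •
    (H.seqU z.1 z.2 *ᵥ Ψ)

/-- The average of the contributions of all paths. -/
noncomputable def meanKet (H : PauliHamiltonian n) (β : ℝ) (p : Params) (Ψ : Ket n) : Ket n :=
  fun x => ∫ z, pathKet H β p Ψ z x ∂(pathMeasure H p)

theorem norm_exp_I_mul_mul (a b : ℝ) : ‖Complex.exp (Complex.I * a * b)‖ = 1 := by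
  rw [mul_assoc, mul_comm, ← Complex.ofReal_mul, Complex.norm_exp_ofReal_mul_I]

theorem integrable_pathKet (hH : 0 < H.hTot) (hβ : 0 < β) (hT : 0 < p.T) (hN : p.Nt ≠ 0)
    {Ψ : Ket n} (hΨ : braket Ψ Ψ = 1) (x : Qubits n) :
    Integrable (fun z => pathKet H β p Ψ z x) (pathMeasure H p) := by
  refine (integrable_pathWeight hH hβ hT hN).mono ?_ (ae_of_all _ fun z => ?_)
  · have h1 := (continuous_g hβ p.τ).measurable
    have h2 := H.measurable_prod_seqCoeff p.Nt
    have h3 := H.measurable_prod_seqU_mulVec p.Nt Ψ x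
    simp only [pathKet, Pi.smul_apply, smul_eq_mul]
    have h4 : Measurable fun z : ℝ × (Fin p.Nt → LORLabel H.M) => g β p.τ z.1 :=
      h1.comp measurable_fst
    exact ((h4.complex_ofReal.mul (by fun_prop)).mul h2 |>.mul h3).aestronglyMeasurable
  · simp only [pathKet, Pi.smul_apply, smul_eq_mul, norm_mul, norm_exp_I_mul_mul, mul_one,
      PauliHamiltonian.norm_seqCoeff, Complex.norm_real]
    rw [pathWeight, norm_mul, Real.norm_of_nonneg (H.seqWeight_nonneg _ _)]
    refine mul_le_of_le_one_right (mul_nonneg (norm_nonneg _) (H.seqWeight_nonneg _ _)) ?_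
    refine (norm_apply_le_ketNorm _ x).trans ?_
    rw [ketNorm_unitary_mulVec (H.seqU_mem_unitaryGroup _ _), ketNorm_eq_one hΨ]

/-- Fubini: at fixed `t ≠ 0` the sum over label sequences reassembles the exact evolution operator,
and `t = 0` is a null set. -/
theorem meanKet_apply (hH : 0 < H.hTot) (hβ : 0 < β) (hT : 0 < p.T) (hN : p.Nt ≠ 0)
    {Ψ : Ket n} (hΨ : braket Ψ Ψ = 1) (x : Qubits n) :
    meanKet H β p Ψ x = ∫ t in Set.Icc (-p.T) p.T,
      (g β p.τ t : ℂ) * Complex.exp (Complex.I * p.E₀ * t)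
        * (NormedSpace.exp ((-(Complex.I * t)) • H.toOp) *ᵥ Ψ) x := by
  have hi := integrable_pathKet hH hβ hT hN hΨ x
  unfold meanKet pathMeasure at *
  rw [integral_prod _ hi]
  have h0 : ∀ᵐ t ∂(volume.restrict (Set.Icc (-p.T) p.T)), t ≠ 0 :=
    compl_mem_ae_iff.2 (measure_singleton 0)
  refine integral_congr_ae ?_
  filter_upwards [hi.prod_right_ae, h0] with t hit ht
  rw [integral_countable hit]
  have hs := H.hasSum_seqCoeff_smul_seqU hH ht hN
  -- The operator-valued sum is carried through the continuous additive map that takes `A` to the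
  -- coordinate `x` of `AΨ`.
  have hm := hs.map (⟨⟨fun A : Op n => (A *ᵥ Ψ) x, by simp⟩, by
    intro A B; simp [Matrix.add_mulVec]⟩ : Op n →+ ℂ) (by
      change Continuous fun A : Op n => (A *ᵥ Ψ) x
      simp only [Matrix.mulVec, dotProduct]; fun_prop)
  have hm' := hm.mul_left ((g β p.τ t : ℂ) * Complex.exp (Complex.I * p.E₀ * t))
  refine Eq.trans ?_ hm'.tsum_eq
  refine tsum_congr fun S => ?_
  simp [pathKet, Measure.real, Matrix.smul_mulVec, mul_assoc]

variable {n : ℕ} {H : PauliHamiltonian n} {β : ℝ} {p : Params} {Ψ : Ket n} {O : Observable n}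

/-! ### The law of one sample -/

/-- The matrix element `⟨Ψ|U_𝐒'(t')† O_j U_𝐒(t)|Ψ⟩` estimated by the Hadamard tests. -/
noncomputable def pathElement (H : PauliHamiltonian n) (p : Params) (Ψ : Ket n) (O : Observable n)
    (a b : ℝ × (Fin p.Nt → LORLabel H.M)) (j : Fin O.K) : ℂ :=
  braket (H.seqU b.1 b.2 *ᵥ Ψ) (O.op j *ᵥ (H.seqU a.1 a.2 *ᵥ Ψ))

theorem norm_pathElement_le (hΨ : braket Ψ Ψ = 1) (a b : ℝ × (Fin p.Nt → LORLabel H.M))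
    (j : Fin O.K) : ‖pathElement H p Ψ O a b j‖ ≤ 1 :=
  norm_braket_unitary_le (H.seqU_mem_unitaryGroup _ _) (O.isUnitary j)
    (H.seqU_mem_unitaryGroup _ _) hΨ

theorem sampleDensity_eq (hΨ : braket Ψ Ψ = 1) (a b : ℝ × (Fin p.Nt → LORLabel H.M))
    (j : Fin O.K) (bR bI : Bool) :
    sampleDensity H β p Ψ O (a, b, j, bR, bI)
      = (CT H β p ^ 2)⁻¹ * (pathWeight H β p a * pathWeight H β p b) * ((|O.a j| / O.aTot)
        * ((1 + outcome bR * (pathElement H p Ψ O a b j).re) / 2)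
        * ((1 + outcome bI * (pathElement H p Ψ O a b j).im) / 2)) := by
  obtain ⟨t, S⟩ := a
  obtain ⟨t', S'⟩ := b
  have h1 := H.seqU_mem_unitaryGroup t S
  have h2 := H.seqU_mem_unitaryGroup t' S'
  simp only [sampleDensity, ancillaProb_X h2 (O.isUnitary j) h1 hΨ,
    ancillaProb_Y h2 (O.isUnitary j) h1 hΨ, pathElement, pathWeight]
  ring

theorem Observable.aTot_nonneg (O : Observable n) : 0 ≤ O.aTot :=
  Finset.sum_nonneg fun _ _ => abs_nonneg _

theorem sampleDensity_nonneg (hβ : 0 < β) (hΨ : braket Ψ Ψ = 1) (ω : Sample H p O) :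
    0 ≤ sampleDensity H β p Ψ O ω := by
  obtain ⟨a, b, j, bR, bI⟩ := ω
  rw [sampleDensity_eq hΨ]
  have h := norm_pathElement_le (H := H) (p := p) (O := O) hΨ a b j
  refine mul_nonneg (mul_nonneg (by positivity)
    (mul_nonneg (pathWeight_nonneg hβ a) (pathWeight_nonneg hβ b)))
    (mul_nonneg (mul_nonneg (div_nonneg (abs_nonneg _) O.aTot_nonneg) ?_) ?_)
  · exact one_add_outcome_mul_nonneg ((Complex.abs_re_le_norm _).trans h) bR
  · exact one_add_outcome_mul_nonneg ((Complex.abs_im_le_norm _).trans h) bI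

theorem measurable_sampleDensity (hβ : 0 < β) (hΨ : braket Ψ Ψ = 1) :
    Measurable (sampleDensity H β p Ψ O) := by
  have hw : Measurable (pathWeight H β p) := measurable_pathWeight hβ
  have ha : Measurable fun ω : Sample H p O => ω.1 := measurable_fst
  have hb : Measurable fun ω : Sample H p O => ω.2.1 := measurable_snd.fst
  have hj : Measurable fun ω : Sample H p O => ω.2.2.1 := measurable_snd.snd.fst
  have hR : Measurable fun ω : Sample H p O => ω.2.2.2.1 := measurable_snd.snd.snd.fst
  have hI : Measurable fun ω : Sample H p O => ω.2.2.2.2 := measurable_snd.snd.snd.snd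
  have hz : Measurable fun ω : Sample H p O => pathElement H p Ψ O ω.1 ω.2.1 ω.2.2.1 := by
    simp only [pathElement, braket_mulVec_eq_sum]
    refine Finset.measurable_fun_sum _ fun x _ => Finset.measurable_fun_sum _ fun y _ => ?_
    exact ((continuous_star.measurable.comp
      ((H.measurable_prod_seqU_mulVec p.Nt Ψ x).comp hb))).mul
      (((Measurable.of_discrete (f := fun j => O.op j x y)).comp hj).mul
        ((H.measurable_prod_seqU_mulVec p.Nt Ψ y).comp ha))
  have ho : Measurable outcome := Measurable.of_discrete
  have hA : Measurable fun j => |O.a j| / O.aTot := Measurable.of_discrete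
  have : sampleDensity H β p Ψ O = fun ω : Sample H p O => (CT H β p ^ 2)⁻¹ *
      (pathWeight H β p ω.1 * pathWeight H β p ω.2.1) * ((|O.a ω.2.2.1| / O.aTot)
        * ((1 + outcome ω.2.2.2.1 * (pathElement H p Ψ O ω.1 ω.2.1 ω.2.2.1).re) / 2)
        * ((1 + outcome ω.2.2.2.2 * (pathElement H p Ψ O ω.1 ω.2.1 ω.2.2.1).im) / 2)) :=
    funext fun ω => sampleDensity_eq hΨ ω.1 ω.2.1 ω.2.2.1 ω.2.2.2.1 ω.2.2.2.2
  rw [this]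
  have h1 := hw.comp ha
  have h2 := hw.comp hb
  have h3 := hA.comp hj
  have h4 := ho.comp hR
  have h5 := ho.comp hI
  have h6 := Complex.measurable_re.comp hz
  have h7 := Complex.measurable_im.comp hz
  exact ((h1.mul h2).const_mul _).mul ((h3.mul (((h4.mul h6).const_add 1).div_const 2)).mul
    (((h5.mul h7).const_add 1).div_const 2))

theorem measurable_sampleValue : Measurable (sampleValue H p O) := by
  have ha : Measurable fun ω : Sample H p O => ω.1 := measurable_fst
  have hb : Measurable fun ω : Sample H p O => ω.2.1 := measurable_snd.fst
  have hj : Measurable fun ω : Sample H p O => ω.2.2.1 := measurable_snd.snd.fst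
  have hR : Measurable fun ω : Sample H p O => ω.2.2.2.1 := measurable_snd.snd.snd.fst
  have hI : Measurable fun ω : Sample H p O => ω.2.2.2.2 := measurable_snd.snd.snd.snd
  have ho : Measurable fun b => (outcome b : ℂ) := Measurable.of_discrete
  have hA : Measurable fun j => (Real.sign (O.a j) : ℂ) := Measurable.of_discrete
  have h1 := ((H.measurable_prod_seqTheta p.Nt).comp ha).complex_ofReal
  have h2 := ((H.measurable_prod_seqTheta p.Nt).comp hb).complex_ofReal
  have h3 := ho.comp hR
  have h4 := ho.comp hI
  have h5 := hA.comp hj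
  have h6 : Measurable fun ω : Sample H p O => ((ω.1.1 : ℝ) : ℂ) := by fun_prop
  have h7 : Measurable fun ω : Sample H p O => ((ω.2.1.1 : ℝ) : ℂ) := by fun_prop
  exact (((h5.mul (Complex.measurable_exp.comp ((h6.sub h7).const_mul _))).mul
    (Complex.measurable_exp.comp (h1.const_mul Complex.I))).mul
    (Complex.measurable_exp.comp (h2.const_mul Complex.I).neg)).mul
    (h3.add (h4.const_mul Complex.I))

theorem norm_sampleValue_sq_le (ω : Sample H p O) : ‖sampleValue H p O ω‖ ^ 2 ≤ 2 := by
  obtain ⟨⟨t, S⟩, ⟨t', S'⟩, j, bR, bI⟩ := ω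
  have h1 : ‖(Real.sign (O.a j) : ℂ)‖ ≤ 1 := by
    rw [Complex.norm_real]
    rcases Real.sign_apply_eq (O.a j) with h | h | h <;> simp [h]
  have h2 : ‖Complex.exp (Complex.I * p.E₀ * (t - t'))‖ = 1 := by
    rw [← Complex.ofReal_sub]; exact norm_exp_I_mul_mul _ _
  have h3 : ‖Complex.exp (Complex.I * H.seqTheta t S)‖ = 1 := by
    rw [mul_comm, Complex.norm_exp_ofReal_mul_I]
  have h4 : ‖Complex.exp (-(Complex.I * H.seqTheta t' S'))‖ = 1 := by
    rw [← mul_neg, mul_comm, ← Complex.ofReal_neg, Complex.norm_exp_ofReal_mul_I]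
  have h5 : ‖(outcome bR : ℂ) + Complex.I * outcome bI‖ ^ 2 = 2 := by
    rw [Complex.sq_norm, Complex.normSq_apply]
    cases bR <;> cases bI <;> simp [outcome] <;> norm_num
  simp only [sampleValue, norm_mul, h2, h3, h4, mul_one, mul_pow, h5]
  have : ‖(Real.sign (O.a j) : ℂ)‖ ^ 2 ≤ 1 := pow_le_one₀ (norm_nonneg _) h1
  linarith

/-- The reference measure on samples. -/
noncomputable def sampleRef (H : PauliHamiltonian n) (p : Params) (O : Observable n) :
    Measure (Sample H p O) :=
  (pathMeasure H p).prod ((pathMeasure H p).prod Measure.count)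

theorem sampleLaw_eq :
    sampleLaw H β p Ψ O
      = (sampleRef H p O).withDensity fun ω => ENNReal.ofReal (sampleDensity H β p Ψ O ω) := rfl

theorem sum_shot_probability (x y c : ℝ) :
    ∑ bR : Bool, ∑ bI : Bool, c * ((1 + outcome bR * x) / 2) * ((1 + outcome bI * y) / 2) = c := by
  simp [outcome]; ring

theorem sum_sampleDensity (hO : 0 < O.aTot) (hΨ : braket Ψ Ψ = 1)
    (a b : ℝ × (Fin p.Nt → LORLabel H.M)) :
    ∑ c : Fin O.K × Bool × Bool, sampleDensity H β p Ψ O (a, b, c)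
      = (CT H β p ^ 2)⁻¹ * (pathWeight H β p a * pathWeight H β p b) := by
  have h1 : ∀ j : Fin O.K, ∑ bR : Bool, ∑ bI : Bool, sampleDensity H β p Ψ O (a, b, j, bR, bI)
      = (CT H β p ^ 2)⁻¹ * (pathWeight H β p a * pathWeight H β p b) * (|O.a j| / O.aTot) := by
    intro j
    rw [← sum_shot_probability (pathElement H p Ψ O a b j).re (pathElement H p Ψ O a b j).im
      ((CT H β p ^ 2)⁻¹ * (pathWeight H β p a * pathWeight H β p b) * (|O.a j| / O.aTot))]
    refine Finset.sum_congr rfl fun bR _ => Finset.sum_congr rfl fun bI _ => ?_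
    rw [sampleDensity_eq hΨ]
    ring
  simp only [Fintype.sum_prod_type, h1]
  rw [← Finset.mul_sum, ← Finset.sum_div, ← Observable.aTot, div_self hO.ne', mul_one]

theorem lintegral_sampleDensity (hH : 0 < H.hTot) (hβ : 0 < β) (hT : 0 < p.T) (hN : p.Nt ≠ 0)
    (hO : 0 < O.aTot) (hΨ : braket Ψ Ψ = 1) :
    ∫⁻ ω, ENNReal.ofReal (sampleDensity H β p Ψ O ω) ∂(sampleRef H p O) = 1 := by
  have hm := (measurable_sampleDensity (H := H) (p := p) (O := O) hβ hΨ).ennreal_ofReal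
  have hw : Measurable fun z => ENNReal.ofReal (pathWeight H β p z) :=
    (measurable_pathWeight hβ).ennreal_ofReal
  have hC := CT_pos hH hβ hT hN
  unfold sampleRef
  rw [lintegral_prod _ hm.aemeasurable]
  have inner : ∀ a, ∫⁻ y, ENNReal.ofReal (sampleDensity H β p Ψ O (a, y))
        ∂((pathMeasure H p).prod Measure.count)
      = ENNReal.ofReal ((CT H β p ^ 2)⁻¹) * ENNReal.ofReal (pathWeight H β p a)
        * ENNReal.ofReal (CT H β p) := by
    intro a
    rw [lintegral_prod (fun y => ENNReal.ofReal (sampleDensity H β p Ψ O (a, y)))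
      (hm.comp measurable_prodMk_left).aemeasurable]
    have : ∀ b, ∫⁻ c, ENNReal.ofReal (sampleDensity H β p Ψ O (a, b, c)) ∂Measure.count
        = ENNReal.ofReal ((CT H β p ^ 2)⁻¹) * ENNReal.ofReal (pathWeight H β p a)
          * ENNReal.ofReal (pathWeight H β p b) := by
      intro b
      rw [lintegral_count, tsum_fintype, ← ENNReal.ofReal_sum_of_nonneg
        (fun c _ => sampleDensity_nonneg hβ hΨ _), sum_sampleDensity hO hΨ,
        ENNReal.ofReal_mul (by positivity), ENNReal.ofReal_mul (pathWeight_nonneg hβ a), mul_assoc]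
    simp_rw [this]
    rw [lintegral_const_mul _ hw, lintegral_pathWeight hH hβ hT hN]
  simp_rw [inner]
  rw [lintegral_mul_const _ (hw.const_mul _), lintegral_const_mul _ hw,
    lintegral_pathWeight hH hβ hT hN, ← ENNReal.ofReal_mul (by positivity),
    ← ENNReal.ofReal_mul (by positivity), ← ENNReal.ofReal_one]
  congr 1
  field_simp

theorem isProbabilityMeasure_sampleLaw (hH : 0 < H.hTot) (hβ : 0 < β) (hT : 0 < p.T)
    (hN : p.Nt ≠ 0) (hO : 0 < O.aTot) (hΨ : braket Ψ Ψ = 1) :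
    IsProbabilityMeasure (sampleLaw H β p Ψ O) := by
  rw [sampleLaw_eq]
  refine ⟨?_⟩
  rw [withDensity_apply _ MeasurableSet.univ, Measure.restrict_univ]
  exact lintegral_sampleDensity hH hβ hT hN hO hΨ

/-! ### The expected value of one sample -/

theorem sum_shot_value (z : ℂ) :
    ∑ bR : Bool, ∑ bI : Bool,
      ((((1 + outcome bR * z.re) / 2) * ((1 + outcome bI * z.im) / 2) : ℝ) : ℂ) * (outcome bR + Complex.I * outcome bI) = z := by
  refine Eq.trans ?_ (Complex.re_add_im z)
  simp [outcome, -Complex.re_add_im]; ring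

theorem sign_mul_abs (x : ℝ) : Real.sign x * |x| = x := by
  rcases lt_trichotomy x 0 with h | h | h
  · rw [Real.sign_of_neg h, abs_of_neg h]; ring
  · simp [h]
  · rw [Real.sign_of_pos h, abs_of_pos h]; ring

/-- Averaging over the shots replaces `μ_R + i μ_I` by the matrix element, and `sgn(a_j) |a_j| =
a_j` restores `O`. What remains is sesquilinear in the two paths. -/
theorem sum_sampleDensity_mul_sampleValue (hΨ : braket Ψ Ψ = 1)
    (a b : ℝ × (Fin p.Nt → LORLabel H.M)) :
    ∑ c : Fin O.K × Bool × Bool,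
        (sampleDensity H β p Ψ O (a, b, c) : ℂ) * sampleValue H p O (a, b, c)
      = ((CT H β p ^ 2 * O.aTot : ℝ) : ℂ)⁻¹ *
        braket (pathKet H β p Ψ b) (O.toOp *ᵥ pathKet H β p Ψ a) := by
  obtain ⟨t, S⟩ := a
  obtain ⟨t', S'⟩ := b
  set Q : ℂ := ((CT H β p ^ 2)⁻¹ * (pathWeight H β p (t, S) * pathWeight H β p (t', S')) : ℝ)
    * (Complex.exp (Complex.I * p.E₀ * (t - t')) * Complex.exp (Complex.I * H.seqTheta t S)
      * Complex.exp (-(Complex.I * H.seqTheta t' S'))) with hQ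
  have h1 : ∀ j : Fin O.K, ∑ bR : Bool, ∑ bI : Bool,
      (sampleDensity H β p Ψ O ((t, S), (t', S'), j, bR, bI) : ℂ)
        * sampleValue H p O ((t, S), (t', S'), j, bR, bI)
      = Q * ((O.aTot : ℂ)⁻¹ * ((O.a j : ℂ) * pathElement H p Ψ O (t, S) (t', S') j)) := by
    intro j
    conv_rhs => rw [← sum_shot_value (pathElement H p Ψ O (t, S) (t', S') j),
      ← sign_mul_abs (O.a j)]
    simp only [Finset.mul_sum]
    refine Finset.sum_congr rfl fun bR _ => Finset.sum_congr rfl fun bI _ => ?_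
    rw [sampleDensity_eq hΨ, hQ]
    simp only [sampleValue]
    push_cast
    ring
  simp only [Fintype.sum_prod_type, h1]
  rw [← Finset.mul_sum, ← Finset.mul_sum]
  simp only [pathElement]
  rw [← O.braket_toOp]
  simp only [pathKet]
  rw [Matrix.mulVec_smul, braket_smul_right, braket_smul_left, H.seqCoeff_eq, H.seqCoeff_eq, hQ]
  simp only [pathWeight, star_mul', RCLike.star_def, Complex.conj_ofReal, ← Complex.exp_conj,
    map_mul, Complex.conj_I]
  have e1 : Complex.exp (Complex.I * p.E₀ * (t - t'))
      = Complex.exp (Complex.I * p.E₀ * t) * Complex.exp (-Complex.I * p.E₀ * t') := by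
    rw [← Complex.exp_add]; congr 1; ring
  rw [e1, neg_mul_eq_neg_mul]
  push_cast
  rw [mul_inv]
  ring

theorem integrable_sampleDensity (hH : 0 < H.hTot) (hβ : 0 < β) (hT : 0 < p.T) (hN : p.Nt ≠ 0)
    (hO : 0 < O.aTot) (hΨ : braket Ψ Ψ = 1) :
    Integrable (sampleDensity H β p Ψ O) (sampleRef H p O) := by
  refine ⟨(measurable_sampleDensity hβ hΨ).aestronglyMeasurable, ?_⟩
  rw [hasFiniteIntegral_iff_ofReal (ae_of_all _ (sampleDensity_nonneg hβ hΨ)),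
    lintegral_sampleDensity hH hβ hT hN hO hΨ]
  exact ENNReal.one_lt_top

theorem norm_sampleValue_le (ω : Sample H p O) : ‖sampleValue H p O ω‖ ≤ 2 := by
  have := norm_sampleValue_sq_le ω
  nlinarith [norm_nonneg (sampleValue H p O ω)]

theorem integral_sum_sum {ι α : Type*} [Fintype ι] [MeasurableSpace α] {μ : Measure α}
    (F : ι → ι → α → ℂ) (hF : ∀ x y, Integrable (F x y) μ) :
    ∫ z, ∑ x, ∑ y, F x y z ∂μ = ∑ x, ∑ y, ∫ z, F x y z ∂μ := by
  rw [integral_finsetSum _ fun x _ => integrable_finsetSum _ fun y _ => hF x y]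
  exact Finset.sum_congr rfl fun x _ => integral_finsetSum _ fun y _ => hF x y

theorem integrable_star {α : Type*} [MeasurableSpace α] {μ : Measure α} {f : α → ℂ}
    (hf : Integrable f μ) : Integrable (fun z => star (f z)) μ :=
  hf.mono (continuous_star.comp_aestronglyMeasurable hf.aestronglyMeasurable)
    (ae_of_all _ fun z => (norm_star (f z)).le)

/-- The two paths are independent and enter sesquilinearly, so each integral passes into its own
argument, coordinate by coordinate. -/
theorem integral_sampleValue (hH : 0 < H.hTot) (hβ : 0 < β) (hT : 0 < p.T) (hN : p.Nt ≠ 0)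
    (hO : 0 < O.aTot) (hΨ : braket Ψ Ψ = 1) :
    ∫ ω, sampleValue H p O ω ∂(sampleLaw H β p Ψ O)
      = ((CT H β p ^ 2 * O.aTot : ℝ) : ℂ)⁻¹ *
        braket (meanKet H β p Ψ) (O.toOp *ᵥ meanKet H β p Ψ) := by
  have hf := integrable_pathKet hH hβ hT hN hΨ
  rw [sampleLaw_eq, integral_withDensity_eq_integral_toReal_smul
    (measurable_sampleDensity hβ hΨ).ennreal_ofReal (ae_of_all _ fun _ => ENNReal.ofReal_lt_top)]
  simp_rw [ENNReal.toReal_ofReal (sampleDensity_nonneg hβ hΨ _), Complex.real_smul]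
  have hint : Integrable (fun ω => (sampleDensity H β p Ψ O ω : ℂ) * sampleValue H p O ω)
      (sampleRef H p O) :=
    (integrable_sampleDensity hH hβ hT hN hO hΨ).ofReal.mul_bdd (c := 2)
      measurable_sampleValue.aestronglyMeasurable (ae_of_all _ norm_sampleValue_le)
  unfold sampleRef at *
  rw [integral_prod _ hint]
  have h1 : ∀ᵐ a ∂(pathMeasure H p), ∫ y, (sampleDensity H β p Ψ O (a, y) : ℂ)
        * sampleValue H p O (a, y) ∂((pathMeasure H p).prod Measure.count)
      = ((CT H β p ^ 2 * O.aTot : ℝ) : ℂ)⁻¹ *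
        braket (meanKet H β p Ψ) (O.toOp *ᵥ pathKet H β p Ψ a) := by
    filter_upwards [hint.prod_right_ae] with a ha
    rw [integral_prod _ ha]
    simp_rw [integral_count, sum_sampleDensity_mul_sampleValue hΨ]
    rw [integral_const_mul]
    congr 1
    simp_rw [braket_mulVec_eq_sum]
    rw [integral_sum_sum (fun x y z => star (pathKet H β p Ψ z x)
      * (O.toOp x y * pathKet H β p Ψ a y)) fun x y => (integrable_star (hf x)).mul_const _]
    refine Finset.sum_congr rfl fun x _ => Finset.sum_congr rfl fun y _ => ?_
    rw [integral_mul_const]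
    congr 1
    exact integral_conj
  rw [integral_congr_ae h1, integral_const_mul]
  congr 1
  simp_rw [braket_mulVec_eq_sum]
  rw [integral_sum_sum (fun x y z => star (meanKet H β p Ψ x)
    * (O.toOp x y * pathKet H β p Ψ z y)) fun x y => ((hf y).const_mul _).const_mul _]
  refine Finset.sum_congr rfl fun x _ => Finset.sum_congr rfl fun y _ => ?_
  rw [integral_const_mul, integral_const_mul]
  rfl

/-! ### Chebyshev's inequality for sums of independent complex samples -/

section Chebyshev

open ProbabilityTheory

theorem integral_sq_sum_sub_le {Ω : Type*} [MeasurableSpace Ω] (μ : Measure Ω)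
    [IsProbabilityMeasure μ] {Y : Ω → ℝ} (hY : MemLp Y 2 μ) (N : ℕ) :
    Integrable (fun ω : Fin N → Ω => (∑ l, Y (ω l) - N * ∫ x, Y x ∂μ) ^ 2)
      (Measure.pi fun _ => μ) ∧
    ∫ ω : Fin N → Ω, (∑ l, Y (ω l) - N * ∫ x, Y x ∂μ) ^ 2 ∂(Measure.pi fun _ => μ)
      ≤ N * ∫ x, Y x ^ 2 ∂μ := by
  set P : Measure (Fin N → Ω) := Measure.pi fun _ => μ
  have hmp : ∀ l : Fin N, MeasurePreserving (Function.eval l) P μ :=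
    fun l => measurePreserving_eval (fun _ => μ) l
  have hYl : ∀ l : Fin N, MemLp (fun ω : Fin N → Ω => Y (ω l)) 2 P :=
    fun l => hY.comp_measurePreserving (hmp l)
  have hS : MemLp (fun ω : Fin N → Ω => ∑ l, Y (ω l)) 2 P := memLp_finsetSum _ fun l _ => hYl l
  have hE : ∫ ω, ∑ l, Y (ω l) ∂P = N * ∫ x, Y x ∂μ := by
    rw [integral_finsetSum _ fun l _ => (hYl l).integrable one_le_two]
    have : ∀ l : Fin N, ∫ ω, Y (ω l) ∂P = ∫ x, Y x ∂μ := fun l =>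
      integral_comp_eval (μ := fun _ : Fin N => μ) hY.aestronglyMeasurable
    simp [this]
  have hV : Var[fun ω : Fin N → Ω => ∑ l, Y (ω l); P] = N * Var[Y; μ] := by
    have := variance_sum_pi (μ := fun _ : Fin N => μ) (X := fun _ => Y) fun _ => hY
    have e : (∑ l : Fin N, fun ω : Fin N → Ω => Y (ω l)) = fun ω => ∑ l, Y (ω l) := by
      ext ω; simp
    rw [e] at this
    rw [this]; simp
  rw [← hE]
  refine ⟨(hS.sub (memLp_const _)).integrable_sq, ?_⟩
  rw [← variance_eq_integral hS.aestronglyMeasurable.aemeasurable, hV]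
  exact mul_le_mul_of_nonneg_left (variance_le_expectation_sq hY.aestronglyMeasurable)
    (Nat.cast_nonneg N)

/-- The second moments of the real and imaginary parts are added before the bound on `‖X‖ ^ 2` is
applied, so no factor is lost; then Markov's inequality for the squared modulus. -/
theorem measureReal_norm_sum_sub_ge_le {Ω : Type*} [MeasurableSpace Ω] (μ : Measure Ω)
    [IsProbabilityMeasure μ] {X : Ω → ℂ} (hX : Measurable X) {B : ℝ} (hB : ∀ x, ‖X x‖ ^ 2 ≤ B)
    (N : ℕ) {δ : ℝ} (hδ : 0 < δ) :
    (Measure.pi fun _ : Fin N => μ).real {ω | δ ≤ ‖∑ l, X (ω l) - N * ∫ x, X x ∂μ‖}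
      ≤ N * B / δ ^ 2 := by
  set P : Measure (Fin N → Ω) := Measure.pi fun _ => μ
  have hb : ∀ x, ‖X x‖ ≤ √B := fun x => Real.le_sqrt_of_sq_le (hB x)
  have hXp : MemLp X 2 μ := MemLp.of_bound hX.aestronglyMeasurable _ (ae_of_all _ hb)
  have hXi : Integrable X μ := hXp.integrable one_le_two
  have hR : MemLp (fun x => (X x).re) 2 μ := hXp.re
  have hI : MemLp (fun x => (X x).im) 2 μ := hXp.im
  obtain ⟨i1, l1⟩ := integral_sq_sum_sub_le μ hR N
  obtain ⟨i2, l2⟩ := integral_sq_sum_sub_le μ hI N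
  have hre : ∫ x, (X x).re ∂μ = (∫ x, X x ∂μ).re := integral_re hXi
  have him : ∫ x, (X x).im ∂μ = (∫ x, X x ∂μ).im := integral_im hXi
  rw [hre] at i1 l1
  rw [him] at i2 l2
  have hn : ∀ ω : Fin N → Ω, ‖∑ l, X (ω l) - N * ∫ x, X x ∂μ‖ ^ 2
      = (∑ l, (X (ω l)).re - N * (∫ x, X x ∂μ).re) ^ 2
        + (∑ l, (X (ω l)).im - N * (∫ x, X x ∂μ).im) ^ 2 := by
    intro ω
    rw [Complex.sq_norm, Complex.normSq_apply]
    simp [pow_two]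
  have hint : Integrable (fun ω : Fin N → Ω => ‖∑ l, X (ω l) - N * ∫ x, X x ∂μ‖ ^ 2) P := by
    simp_rw [hn]; exact i1.add i2
  have hle : ∫ ω, ‖∑ l, X (ω l) - N * ∫ x, X x ∂μ‖ ^ 2 ∂P ≤ N * B := by
    simp_rw [hn]
    rw [integral_add i1 i2]
    refine (add_le_add l1 l2).trans ?_
    rw [← mul_add, ← integral_add hR.integrable_sq hI.integrable_sq]
    refine mul_le_mul_of_nonneg_left ?_ (Nat.cast_nonneg N)
    calc _ ≤ ∫ _x, B ∂μ := by
          refine integral_mono (hR.integrable_sq.add hI.integrable_sq) (integrable_const _)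
            fun x => ?_
          refine le_trans (le_of_eq ?_) (hB x)
          rw [Complex.sq_norm, Complex.normSq_apply]
          simp [pow_two]
      _ = B := by simp
  have hm := mul_meas_ge_le_integral_of_nonneg (μ := P) (ae_of_all _ fun ω => sq_nonneg _) hint
    (δ ^ 2)
  have hset : {ω : Fin N → Ω | δ ≤ ‖∑ l, X (ω l) - N * ∫ x, X x ∂μ‖}
      = {ω | δ ^ 2 ≤ ‖∑ l, X (ω l) - N * ∫ x, X x ∂μ‖ ^ 2} := by
    ext ω
    exact (pow_le_pow_iff_left₀ hδ.le (norm_nonneg _) two_ne_zero).symm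
  rw [hset, le_div_iff₀ (by positivity), mul_comm]
  exact hm.trans hle

end Chebyshev

/-! ### Functions of the Hamiltonian -/

section Spectral

variable {ι : Type} [Fintype ι] [DecidableEq ι] {A : Matrix ι ι ℂ} (hA : A.IsHermitian)

/-- The state `f(A)|Ψ⟩`, where `f` is a function on the spectrum of `A`. -/
noncomputable def funKet (f : ℝ → ℂ) (Ψ : ι → ℂ) : ι → ℂ :=
  (hA.eigenvectorUnitary : Matrix ι ι ℂ) *ᵥ fun k =>
    f (hA.eigenvalues k) * ((hA.eigenvectorUnitary : Matrix ι ι ℂ)ᴴ *ᵥ Ψ) k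

theorem exp_smul_mulVec (c : ℂ) (Ψ : ι → ℂ) :
    NormedSpace.exp (c • A) *ᵥ Ψ = funKet hA (fun x => Complex.exp (c * x)) Ψ := by
  set U : Matrix ι ι ℂ := (hA.eigenvectorUnitary : Matrix ι ι ℂ) with hU
  have hUm : U ∈ Matrix.unitaryGroup ι ℂ := hA.eigenvectorUnitary.2
  have hinv : U⁻¹ = Uᴴ := Matrix.inv_eq_left_inv (Matrix.mem_unitaryGroup_iff'.1 hUm)
  have hunit : IsUnit U := IsUnit.of_mul_eq_one _ (Matrix.mem_unitaryGroup_iff.1 hUm)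
  have h1 : c • A = U * Matrix.diagonal (fun k => c * hA.eigenvalues k) * U⁻¹ := by
    conv_lhs => rw [hA.spectral_theorem]
    rw [Unitary.conjStarAlgAut_apply, hinv, ← smul_mul_assoc, ← mul_smul_comm,
      ← Matrix.diagonal_smul]
    rfl
  rw [h1, Matrix.exp_conj _ _ hunit, Matrix.exp_diagonal, hinv, funKet, ← Matrix.mulVec_mulVec,
    ← Matrix.mulVec_mulVec]
  congr 1
  ext k
  rw [Matrix.mulVec_diagonal]
  congr 1
  rw [Pi.coe_exp, Complex.exp_eq_exp_ℂ]

/-- In the eigenbasis both operators are diagonal, so a uniform bound on the spectrum is a bound on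
the states. -/
theorem norm_funKet_sub_le {f f' : ℝ → ℂ} {δ : ℝ} (hδ : 0 ≤ δ)
    (h : ∀ k, ‖f (hA.eigenvalues k) - f' (hA.eigenvalues k)‖ ≤ δ) (Ψ : ι → ℂ) :
    ketNorm (funKet hA f Ψ - funKet hA f' Ψ) ≤ δ * ketNorm Ψ := by
  unfold funKet
  have hUm : (hA.eigenvectorUnitary : Matrix ι ι ℂ)ᴴ ∈ Matrix.unitaryGroup ι ℂ :=
    Unitary.star_mem hA.eigenvectorUnitary.2
  rw [← Matrix.mulVec_sub, ketNorm_unitary_mulVec hA.eigenvectorUnitary.2,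
    ← ketNorm_unitary_mulVec hUm Ψ]
  refine (pow_le_pow_iff_left₀ (ketNorm_nonneg _) (mul_nonneg hδ (ketNorm_nonneg _))
    two_ne_zero).1 ?_
  rw [mul_pow, ketNorm_sq, ketNorm_sq, Finset.mul_sum]
  refine Finset.sum_le_sum fun k _ => ?_
  rw [Pi.sub_apply, ← sub_mul, norm_mul, mul_pow]
  exact mul_le_mul_of_nonneg_right (pow_le_pow_left₀ (norm_nonneg _) (h k) 2) (sq_nonneg _)

theorem norm_funKet_le {f : ℝ → ℂ} {δ : ℝ} (hδ : 0 ≤ δ)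
    (h : ∀ k, ‖f (hA.eigenvalues k)‖ ≤ δ) (Ψ : ι → ℂ) :
    ketNorm (funKet hA f Ψ) ≤ δ * ketNorm Ψ := by
  have := norm_funKet_sub_le hA (f' := fun _ => 0) hδ (by simpa using h) Ψ
  have h0 : funKet hA (fun _ => 0) Ψ = 0 := by
    unfold funKet
    simp only [zero_mul]
    exact Matrix.mulVec_zero _
  rwa [h0, sub_zero] at this

theorem funKet_smul (c : ℂ) (f : ℝ → ℂ) (Ψ : ι → ℂ) :
    c • funKet hA f Ψ = funKet hA (fun x => c * f x) Ψ := by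
  unfold funKet
  rw [← Matrix.mulVec_smul]
  congr 1
  ext k
  simp [mul_assoc]

theorem funKet_eigenvector (f : ℝ → ℂ) {Ψ : ι → ℂ} {E : ℝ} (hΨ : A *ᵥ Ψ = (E : ℂ) • Ψ) :
    funKet hA f Ψ = f E • Ψ := by
  set U : Matrix ι ι ℂ := (hA.eigenvectorUnitary : Matrix ι ι ℂ) with hU
  have hUm : U ∈ Matrix.unitaryGroup ι ℂ := hA.eigenvectorUnitary.2
  have h1 : Uᴴ * A = Matrix.diagonal (fun k => (hA.eigenvalues k : ℂ)) * Uᴴ := by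
    conv_lhs => rw [hA.spectral_theorem]
    rw [Unitary.conjStarAlgAut_apply, ← mul_assoc, ← mul_assoc]
    have : Uᴴ * U = 1 := Matrix.mem_unitaryGroup_iff'.1 hUm
    rw [← hU, this, one_mul]
    rfl
  have h2 : ∀ k, (hA.eigenvalues k : ℂ) * (Uᴴ *ᵥ Ψ) k = E * (Uᴴ *ᵥ Ψ) k := by
    intro k
    have := congrFun (congrArg (fun M => M *ᵥ Ψ) h1) k
    simp only [← Matrix.mulVec_mulVec, hΨ, Matrix.mulVec_smul] at this
    rw [Matrix.mulVec_diagonal] at this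
    exact this.symm
  have h3 : (fun k => f (hA.eigenvalues k) * (Uᴴ *ᵥ Ψ) k) = f E • (Uᴴ *ᵥ Ψ) := by
    ext k
    by_cases h0 : (Uᴴ *ᵥ Ψ) k = 0
    · simp [h0]
    · have := mul_right_cancel₀ h0 (h2 k)
      rw [Complex.ofReal_inj.1 this]; rfl
  unfold funKet
  rw [← hU, h3, Matrix.mulVec_smul, Matrix.mulVec_mulVec]
  have : U * Uᴴ = 1 := Matrix.mem_unitaryGroup_iff.1 hUm
  rw [this, Matrix.one_mulVec]

end Spectral

/-! ### Bias of the estimators -/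

section Bias

variable {n : ℕ} {H : PauliHamiltonian n} {β : ℝ} {p : Params} {Ψ : Ket n} {O : Observable n}

/-- The truncated Fourier transform of the Lorentz–Gaussian function. -/
noncomputable def truncFourier (β : ℝ) (p : Params) (y : ℝ) : ℂ :=
  ∫ t in Set.Icc (-p.T) p.T, (g β p.τ t : ℂ) * Complex.exp (-(Complex.I * y * t))

/-- Here `τ² = 2 β² L`. The truncation exponent `T² / (2 τ²)` equals `L` exactly, and the Chernoff
exponent `τ² y² / 2 = L (β y)²` is at least `L` because `β y ≥ 1`. -/
theorem norm_truncFourier_sub_exp_le {L y : ℝ} (hβ : 0 < β) (hL : 1 ≤ L)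
    (hτ : p.τ = β * √(2 * L)) (hT : p.T = 2 * β * L) (hy : 1 / β ≤ y) :
    ‖truncFourier β p y - Real.exp (-(β * y))‖ ≤ 2 * Real.exp (-L) := by
  have hτ0 : 0 < p.τ := by rw [hτ]; positivity
  have hT0 : 0 < p.T := by rw [hT]; positivity
  have hτ2 : p.τ ^ 2 = 2 * β ^ 2 * L := by
    rw [hτ, mul_pow, Real.sq_sqrt (by positivity)]; ring
  have hy1 : 1 ≤ y * β := (div_le_iff₀ hβ).1 hy
  have h1 := norm_fourier_g_sub_exp_le (β := β) (τ := p.τ) (x := y) hβ hτ0 (by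
    rw [hτ2]
    have : β * 1 ≤ β * (2 * L * (y * β)) := mul_le_mul_of_nonneg_left (by nlinarith) hβ.le
    linarith)
  have h2 := norm_setIntegral_g_tail_le (β := β) (τ := p.τ) (T := p.T) (x := y) hβ hT0
  have e1 : Real.exp (-(p.τ ^ 2 * y ^ 2 / 2)) ≤ Real.exp (-L) := by
    refine Real.exp_le_exp.2 (neg_le_neg ?_)
    rw [hτ2]
    have : (1 : ℝ) ≤ (y * β) ^ 2 := one_le_pow₀ hy1
    nlinarith
  have e2 : p.T ^ 2 / (2 * p.τ ^ 2) = L := by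
    rw [hτ2, hT]; field_simp
  rw [e2] at h2
  rw [truncFourier]
  set a := ∫ t : ℝ, (g β p.τ t : ℂ) * Complex.exp (-(Complex.I * y * t))
  set b := ∫ t in Set.Icc (-p.T) p.T, (g β p.τ t : ℂ) * Complex.exp (-(Complex.I * y * t))
  have := norm_add_le (b - a) (a - Real.exp (-(β * y)))
  rw [sub_add_sub_cancel, norm_sub_rev b a] at this
  linarith

theorem meanKet_eq_funKet (hH : 0 < H.hTot) (hβ : 0 < β) (hT : 0 < p.T) (hN : p.Nt ≠ 0)
    (hΨ : braket Ψ Ψ = 1) :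
    meanKet H β p Ψ
      = funKet H.toOp_isHermitian (fun x => truncFourier β p (x - p.E₀)) Ψ := by
  ext x
  rw [meanKet_apply hH hβ hT hN hΨ]
  simp_rw [exp_smul_mulVec H.toOp_isHermitian]
  simp only [funKet]
  generalize (H.toOp_isHermitian.eigenvectorUnitary : Op n)ᴴ *ᵥ Ψ = w
  generalize (H.toOp_isHermitian.eigenvectorUnitary : Op n) = U
  simp only [Matrix.mulVec, dotProduct, Finset.mul_sum]
  have hc := continuous_g hβ p.τ
  rw [integral_finsetSum _ fun k _ => by
    refine Continuous.integrableOn_Icc ?_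
    fun_prop]
  refine Finset.sum_congr rfl fun k _ => ?_
  rw [mul_left_comm, truncFourier, ← integral_mul_const]
  refine integral_congr_ae (ae_of_all _ fun t => ?_)
  have : Complex.exp (-(Complex.I * (H.toOp_isHermitian.eigenvalues k - p.E₀ : ℝ) * t))
      = Complex.exp (Complex.I * p.E₀ * t)
        * Complex.exp (-(Complex.I * t) * H.toOp_isHermitian.eigenvalues k) := by
    rw [← Complex.exp_add]; congr 1; push_cast; ring
  simp only [this]; ring

/-- The unnormalised imaginary-time evolved state `e^{-β (H̄ - E₀)}|Ψ⟩`. -/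
noncomputable def evolvedKet (H : PauliHamiltonian n) (β E₀ : ℝ) (Ψ : Ket n) : Ket n :=
  funKet H.toOp_isHermitian (fun x => (Real.exp (-(β * (x - E₀))) : ℂ)) Ψ

theorem evolvedKet_eq (E₀ : ℝ) :
    evolvedKet H β E₀ Ψ
      = (Real.exp (β * E₀) : ℂ) • (NormedSpace.exp ((-β : ℂ) • H.toOp) *ᵥ Ψ) := by
  rw [exp_smul_mulVec H.toOp_isHermitian, funKet_smul, evolvedKet]
  congr 1
  ext x
  rw [Complex.ofReal_exp, Complex.ofReal_exp, ← Complex.exp_add]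
  congr 1; push_cast; ring

theorem exp_neg_smul_toOp_conjTranspose :
    (NormedSpace.exp ((-β : ℂ) • H.toOp))ᴴ = NormedSpace.exp ((-β : ℂ) • H.toOp) := by
  rw [← Matrix.exp_conjTranspose, Matrix.conjTranspose_smul, H.toOp_isHermitian.eq]
  simp

/-- The shift multiplies numerator and denominator by the same nonzero factor, and the Hermitian
`e^{-βH̄}` can be split between bra and ket. -/
theorem imagTimeMean_eq (E₀ : ℝ) :
    imagTimeMean H.toOp β Ψ O.toOp
      = braket (evolvedKet H β E₀ Ψ) (O.toOp *ᵥ evolvedKet H β E₀ Ψ)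
        / braket (evolvedKet H β E₀ Ψ) (evolvedKet H β E₀ Ψ) := by
  have h2 : NormedSpace.exp ((-(2 * β) : ℂ) • H.toOp)
      = NormedSpace.exp ((-β : ℂ) • H.toOp) * NormedSpace.exp ((-β : ℂ) • H.toOp) := by
    rw [← Matrix.exp_add_of_commute _ _ (Commute.refl _), ← add_smul]
    congr 2; ring
  rw [imagTimeMean, h2, evolvedKet_eq, Matrix.mulVec_smul, braket_smul_left, braket_smul_right,
    braket_smul_left, braket_smul_right, ← Matrix.mulVec_mulVec, ← Matrix.mulVec_mulVec,
    ← Matrix.mulVec_mulVec]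
  have hs : ∀ u w : Ket n, braket u (NormedSpace.exp ((-β : ℂ) • H.toOp) *ᵥ w)
      = braket (NormedSpace.exp ((-β : ℂ) • H.toOp) *ᵥ u) w := fun u w => by
    rw [braket_mulVec_left, exp_neg_smul_toOp_conjTranspose]
  rw [hs Ψ, hs Ψ]
  have h0 : (Real.exp (β * E₀) : ℂ) ≠ 0 := by exact_mod_cast (Real.exp_pos _).ne'
  have h1 : star (Real.exp (β * E₀) : ℂ) ≠ 0 := star_ne_zero.2 h0
  rw [mul_div_mul_left _ _ h1, mul_div_mul_left _ _ h0]

/-- Cauchy–Schwarz against the ground state, on which the Hermitian evolution acts by a scalar. -/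
theorem ketNorm_evolvedKet_ge {E₀ Eg : ℝ} {Ψg : Ket n} (hg : braket Ψg Ψg = 1)
    (hE : H.toOp *ᵥ Ψg = (Eg : ℂ) • Ψg) :
    Real.exp (-(β * (Eg - E₀))) * ‖braket Ψg Ψ‖ ≤ ketNorm (evolvedKet H β E₀ Ψ) := by
  have h1 : braket Ψg (evolvedKet H β E₀ Ψ)
      = (Real.exp (-(β * (Eg - E₀))) : ℂ) * braket Ψg Ψ := by
    have h2 : evolvedKet H β E₀ Ψg = (Real.exp (-(β * (Eg - E₀))) : ℂ) • Ψg :=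
      funKet_eigenvector H.toOp_isHermitian _ hE
    have h3 := congrArg (fun u => braket u Ψ) h2
    simp only [braket_smul_left, RCLike.star_def, Complex.conj_ofReal] at h3
    rw [← h3, evolvedKet_eq, evolvedKet_eq, braket_smul_left, braket_smul_right,
      braket_mulVec_left, exp_neg_smul_toOp_conjTranspose, RCLike.star_def, Complex.conj_ofReal]
  have h4 := norm_braket_le Ψg (evolvedKet H β E₀ Ψ)
  rwa [h1, ketNorm_eq_one hg, one_mul, norm_mul, Complex.norm_real,
    Real.norm_of_nonneg (Real.exp_pos _).le] at h4

theorem Observable.norm_braket_sub_le (O : Observable n) {v v₀ : Ket n} {δ : ℝ} (hδ : δ ≤ 1)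
    (h : ketNorm (v - v₀) ≤ 2 * δ) (h0 : ketNorm v₀ ≤ 1) :
    ‖braket v (O.toOp *ᵥ v) - braket v₀ (O.toOp *ᵥ v₀)‖ ≤ O.aTot * (8 * δ) := by
  have e : braket v (O.toOp *ᵥ v) - braket v₀ (O.toOp *ᵥ v₀)
      = braket (v - v₀) (O.toOp *ᵥ v) + braket v₀ (O.toOp *ᵥ (v - v₀)) := by
    rw [Matrix.mulVec_sub, braket_sub_right, braket_sub_left]; ring
  have h1 := ketNorm_sub_le v v₀
  have hp := ketNorm_nonneg (v - v₀)
  rw [e]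
  refine (norm_add_le _ _).trans
    ((add_le_add (O.norm_braket_le _ _) (O.norm_braket_le _ _)).trans ?_)
  rw [← mul_add]
  refine mul_le_mul_of_nonneg_left ?_ O.aTot_nonneg
  have h2 : ketNorm (v - v₀) * ketNorm v ≤ (2 * δ) * (1 + 2 * δ) :=
    mul_le_mul h (by linarith) (ketNorm_nonneg _) (by linarith)
  have h3 : ketNorm v₀ * ketNorm (v - v₀) ≤ 1 * (2 * δ) :=
    mul_le_mul h0 h hp zero_le_one
  -- The total is `4δ + 4δ²`, at most `8δ` because `δ ≤ 1`.
  nlinarith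

/-! ### Fluctuations of the estimators -/

theorem measureReal_estimator_ge_le (hH : 0 < H.hTot) (hβ : 0 < β) (hT : 0 < p.T) (hN : p.Nt ≠ 0)
    (hNs : p.Ns ≠ 0) (hO : 0 < O.aTot) (hΨ : braket Ψ Ψ = 1) {ε : ℝ} (hε : 0 < ε) :
    (Measure.pi fun _ : Fin p.Ns => sampleLaw H β p Ψ O).real
        {ω | O.aTot * ε ≤ ‖estimator H β p O ω
          - braket (meanKet H β p Ψ) (O.toOp *ᵥ meanKet H β p Ψ)‖}
      ≤ 2 * CT H β p ^ 4 / (p.Ns * ε ^ 2) := by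
  have := isProbabilityMeasure_sampleLaw hH hβ hT hN hO hΨ
  have hC := CT_pos hH hβ hT hN
  have hNs0 : (0 : ℝ) < p.Ns := by exact_mod_cast Nat.pos_of_ne_zero hNs
  -- A deviation `a_O ε` of the estimator is a deviation `ε N_s / C_T²` of the raw sum; `a_O`
  -- cancels.
  have h := measureReal_norm_sum_sub_ge_le (sampleLaw H β p Ψ O) measurable_sampleValue
    norm_sampleValue_sq_le p.Ns (δ := ε * p.Ns / CT H β p ^ 2) (by positivity)
  have e : (p.Ns : ℝ) * 2 / (ε * p.Ns / CT H β p ^ 2) ^ 2 = 2 * CT H β p ^ 4 / (p.Ns * ε ^ 2) := by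
    field_simp
  rw [e] at h
  refine le_trans (le_of_eq ?_) h
  congr 1
  ext ω
  simp only [Set.mem_ofPred_eq]
  have e2 : estimator H β p O ω - braket (meanKet H β p Ψ) (O.toOp *ᵥ meanKet H β p Ψ)
      = ((O.aTot * CT H β p ^ 2 / p.Ns : ℝ) : ℂ) * (∑ l, sampleValue H p O (ω l)
        - p.Ns * ∫ x, sampleValue H p O x ∂(sampleLaw H β p Ψ O)) := by
    rw [integral_sampleValue hH hβ hT hN hO hΨ, estimator, mul_sub]
    congr 1
    have h1 : (p.Ns : ℂ) ≠ 0 := by exact_mod_cast hNs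
    have h2 : (O.aTot : ℂ) ≠ 0 := by exact_mod_cast hO.ne'
    have h3 : (CT H β p : ℂ) ≠ 0 := by exact_mod_cast hC.ne'
    push_cast
    field_simp
  rw [e2, norm_mul, Complex.norm_real, Real.norm_of_nonneg (by positivity),
    div_le_iff₀ (by positivity)]
  generalize ‖∑ l, sampleValue H p O (ω l)
        - p.Ns * ∫ x, sampleValue H p O x ∂(sampleLaw H β p Ψ O)‖ = r
  have e3 : O.aTot * CT H β p ^ 2 / p.Ns * r = O.aTot * (r * CT H β p ^ 2 / p.Ns) := by ring
  rw [e3, mul_le_mul_iff_right₀ hO, le_div_iff₀ hNs0]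

/-! ### Stability of the quotient and the union bound -/

/-- The error of the quotient is below `18 a ε / ‖D'‖`, and `D'` keeps at least the fraction
`116/125` of `D`. The `9 ε` in the hypotheses stands for a bias `8 ε` plus a fluctuation `ε`. -/
theorem norm_div_sub_div_lt {N' D' N : ℂ} {D a ε η : ℝ} (ha : 0 < a) (hε : 0 < ε) (hη : 0 < η)
    (hN : ‖N‖ ≤ a * D) (h1 : 125 * ε ≤ D) (h2 : 125 * ε ≤ η * D)
    (hN' : ‖N' - N‖ < a * (9 * ε)) (hD' : ‖D' - D‖ < 9 * ε) :
    D' ≠ 0 ∧ ‖N' / D' - N / D‖ < a * η := by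
  have hD : 0 < D := by linarith
  have h3 : D - 9 * ε ≤ ‖D'‖ := by
    have := norm_sub_norm_le (D : ℂ) D'
    rw [norm_sub_rev, Complex.norm_real, Real.norm_of_nonneg hD.le] at this
    linarith
  have hDp : 0 < ‖D'‖ := by linarith
  have hD0 : D' ≠ 0 := norm_pos_iff.1 hDp
  have hDc : (D : ℂ) ≠ 0 := by exact_mod_cast hD.ne'
  refine ⟨hD0, ?_⟩
  have e : N' / D' - N / D = ((N' - N) * D - N * (D' - D)) / (D' * D) := by
    field_simp; ring
  rw [e, norm_div, norm_mul, Complex.norm_real, Real.norm_of_nonneg hD.le,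
    div_lt_iff₀ (by positivity)]
  refine (norm_sub_le _ _).trans_lt ?_
  rw [norm_mul, norm_mul, Complex.norm_real, Real.norm_of_nonneg hD.le]
  have h4 : ‖N' - N‖ * D ≤ a * (9 * ε) * D := mul_le_mul_of_nonneg_right hN'.le hD.le
  have h5 : ‖N‖ * ‖D' - D‖ ≤ a * D * (9 * ε) :=
    mul_le_mul hN hD'.le (norm_nonneg _) (by positivity)
  have h6 : 18 * ε < η * ‖D'‖ := by nlinarith
  have h7 : a * D * (18 * ε) < a * D * (η * ‖D'‖) := by
    apply mul_lt_mul_of_pos_left h6; positivity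
  linarith

end Bias

theorem one_sub_lt_measureReal_of_compl_subset {α γ : Type*} [MeasurableSpace α] [MeasurableSpace γ]
    (μ : Measure α) (ν : Measure γ) [IsProbabilityMeasure μ] [IsProbabilityMeasure ν]
    {E : Set (α × γ)} {s : Set α} {t : Set γ} (h : ∀ ω, ω.1 ∉ s → ω.2 ∉ t → ω ∈ E) {κ : ℝ}
    (hst : μ.real s + ν.real t < κ) : 1 - κ < (μ.prod ν).real E := by
  have h1 : (Set.univ : Set (α × γ)) ⊆ E ∪ (s ×ˢ Set.univ ∪ Set.univ ×ˢ t) := by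
    intro ω _
    by_cases h1 : ω.1 ∈ s
    · exact Or.inr (Or.inl ⟨h1, trivial⟩)
    by_cases h2 : ω.2 ∈ t
    · exact Or.inr (Or.inr ⟨trivial, h2⟩)
    exact Or.inl (h ω h1 h2)
  have h2 := (measureReal_mono (μ := μ.prod ν) h1).trans ((measureReal_union_le _ _).trans
    (add_le_add_right (measureReal_union_le _ _) _))
  simp only [measureReal_prod_prod, probReal_univ, mul_one, one_mul] at h2
  linarith

end ITS

/-! ### Choice of the parameters and conclusion -/

theorem theorem1 :
    ∃ c C : ℝ, 0 < c ∧ 0 < C ∧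
      ∀ β htot Ehat δE pb η κ : ℝ, 0 < β → 0 < htot → 0 ≤ δE → 0 < pb → pb ≤ 1 → 0 < η → 0 < κ →
        ∃ (ε : ℝ) (p : Params),
          (0 < ε ∧ ε < 1 ∧
            c * pb * Real.exp (-(4 * β * δE)) * min η 1 ≤ ε ∧
            ε ≤ C * pb * Real.exp (-(4 * β * δE)) * η) ∧
          (0 < p.τ ∧ 0 < p.T ∧ 1 ≤ p.Nt ∧ 1 ≤ p.Ns) ∧
          p.Nt ≤ ⌈C * (htot ^ 2 * β ^ 2 * Real.log (1 / ε) ^ 2)⌉₊ ∧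
          p.Ns ≤ ⌈C * (1 / (κ * ε ^ 2))⌉₊ ∧
          ∀ (n : ℕ) (H : PauliHamiltonian n) (O : Observable n) (Ψ Ψg : Ket n) (Eg : ℝ),
            H.hTot = htot → 0 < O.aTot →
            braket Ψ Ψ = 1 →
            IsLeast (spectrum ℝ H.toOp) Eg →
            Eg ∈ Set.Icc (Ehat - δE) (Ehat + δE) →
            braket Ψg Ψg = 1 → H.toOp *ᵥ Ψg = (Eg : ℂ) • Ψg →
            pb ≤ ‖braket Ψg Ψ‖ ^ 2 →
            IsProbabilityMeasure (itsLaw H β p Ψ O) ∧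
            1 - κ < (itsLaw H β p Ψ O).real
              {ω | estimator H β p (Observable.identity n) ω.2 ≠ 0 ∧
                ‖estimator H β p O ω.1 / estimator H β p (Observable.identity n) ω.2
                  - imagTimeMean H.toOp β Ψ O.toOp‖ < O.aTot * η} := by
  -- The quotient needs `125 ε ≤ ‖v₀‖²`, and `‖v₀‖² ≥ q / 8`, whence `1/1000`. The constant `3000`
  -- exceeds both the `4` in `(h_tot T)² = 4 h_tot² β² L²` and the `2000` that Chebyshev's
  -- inequality needs with `C_T ^ 4 ≤ 500`.
  refine ⟨1 / 1000, 3000, by norm_num, by norm_num, ?_⟩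
  intro β htot Ehat δE pb η κ hβ hh hδE hpb hpb1 hη hκ
  set q : ℝ := pb * Real.exp (-(4 * β * δE)) with hq
  have hq0 : 0 < q := by positivity
  have hexp1 : Real.exp (-(4 * β * δE)) ≤ 1 := by
    rw [Real.exp_le_one_iff, neg_nonpos]; positivity
  have hq1 : q ≤ 1 := mul_le_one₀ hpb1 (Real.exp_pos _).le hexp1
  have hm0 : 0 < min η 1 := lt_min hη one_pos
  set ε : ℝ := 1 / 1000 * q * min η 1 with hε
  have hε0 : 0 < ε := by positivity
  have hε1 : ε ≤ 1 / 1000 * q := mul_le_of_le_one_right (by positivity) (min_le_right _ _)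
  have hεη : ε ≤ 1 / 1000 * q * η := mul_le_mul_of_nonneg_left (min_le_left _ _) (by positivity)
  have hεle : ε ≤ 1 / 1000 := by linarith
  set L : ℝ := Real.log (1 / ε) with hL
  have hexpL : Real.exp (-L) = ε := by
    rw [hL, one_div, Real.log_inv, neg_neg, Real.exp_log hε0]
  have hL1 : 1 ≤ L := by
    rw [hL, Real.le_log_iff_exp_le (by positivity)]
    have h1 : (1000 : ℝ) ≤ 1 / ε := by rw [le_div_iff₀ hε0]; linarith
    linarith [Real.exp_one_lt_d9]
  -- `Ehat - δE` is a lower bound for the spectrum; the further shift `1 / β` supplies the gap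
  -- required by the Fourier approximation and costs only a constant factor in `‖v₀‖²`.
  let p : Params :=
    { E₀ := Ehat - δE - 1 / β
      τ := β * √(2 * L)
      T := 2 * β * L
      Nt := ⌈3000 * (htot ^ 2 * β ^ 2 * L ^ 2)⌉₊
      Ns := ⌈3000 * (1 / (κ * ε ^ 2))⌉₊ }
  have hτ : 0 < p.τ := by change 0 < β * √(2 * L); positivity
  have hT : 0 < p.T := by change 0 < 2 * β * L; positivity
  have hNt : 1 ≤ p.Nt := Nat.one_le_ceil_iff.2 (by positivity)
  have hNs : 1 ≤ p.Ns := Nat.one_le_ceil_iff.2 (by positivity)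
  refine ⟨ε, p, ⟨hε0, by linarith, ?_, ?_⟩, ⟨hτ, hT, hNt, hNs⟩, le_rfl, le_rfl, ?_⟩
  · rw [mul_assoc (1 / 1000) pb]
  · rw [mul_assoc (3000 : ℝ) pb, ← hq]
    have : 0 < q * η := by positivity
    linarith
  intro n H O Ψ Ψg Eg hHt hO hΨ hEg hEI hg hgE hp
  have hH : 0 < H.hTot := hHt ▸ hh
  have hNt0 : p.Nt ≠ 0 := by omega
  have hNs0 : p.Ns ≠ 0 := by omega
  have hI : 0 < (Observable.identity n).aTot := by rw [Observable.identity_aTot]; exact one_pos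
  have prO := isProbabilityMeasure_sampleLaw hH hβ hT hNt0 hO hΨ
  have prI := isProbabilityMeasure_sampleLaw hH hβ hT hNt0 hI hΨ
  refine ⟨by unfold itsLaw; infer_instance, ?_⟩
  have hgap : ∀ k, 1 / β ≤ H.toOp_isHermitian.eigenvalues k - p.E₀ := by
    intro k
    have h1 : H.toOp_isHermitian.eigenvalues k ∈ spectrum ℝ H.toOp := by
      rw [H.toOp_isHermitian.spectrum_real_eq_range_eigenvalues]; exact ⟨k, rfl⟩
    have h2 := hEg.2 h1
    have h3 := hEI.1
    change 1 / β ≤ _ - (Ehat - δE - 1 / β)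
    linarith
  set v := meanKet H β p Ψ with hv
  set v₀ := evolvedKet H β p.E₀ Ψ with hv₀
  have hΨ1 : ketNorm Ψ = 1 := ketNorm_eq_one hΨ
  have hvv : ketNorm (v - v₀) ≤ 2 * ε := by
    rw [hv, meanKet_eq_funKet hH hβ hT hNt0 hΨ, hv₀, evolvedKet]
    have := norm_funKet_sub_le H.toOp_isHermitian (δ := 2 * ε)
      (f := fun x => truncFourier β p (x - p.E₀))
      (f' := fun x => (Real.exp (-(β * (x - p.E₀))) : ℂ)) (by positivity) (fun k => by
        rw [← hexpL]
        exact norm_truncFourier_sub_exp_le hβ hL1 rfl rfl (hgap k)) Ψ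
    rwa [hΨ1, mul_one] at this
  have hv1 : ketNorm v₀ ≤ 1 := by
    have := norm_funKet_le H.toOp_isHermitian (δ := 1)
      (f := fun x => (Real.exp (-(β * (x - p.E₀))) : ℂ)) zero_le_one (fun k => by
        rw [Complex.norm_real, Real.norm_of_nonneg (Real.exp_pos _).le, Real.exp_le_one_iff,
          neg_nonpos]
        exact mul_nonneg hβ.le (le_trans (by positivity) (hgap k))) Ψ
    rwa [hΨ1, mul_one] at this
  -- Since `Eg - E₀ ≤ 2 δE + 1 / β`, the squared ground-state component is at least `pb * exp (-4 β
  -- δE - 2)`, and `e² < 8`.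
  have hD : q / 8 ≤ ketNorm v₀ ^ 2 := by
    have h1 : Real.exp (-(β * (Eg - p.E₀))) * ‖braket Ψg Ψ‖ ≤ ketNorm v₀ :=
      ketNorm_evolvedKet_ge hg hgE
    have h2 := pow_le_pow_left₀ (by positivity) h1 2
    refine le_trans ?_ h2
    rw [mul_pow, ← Real.exp_nat_mul, hq]
    have h3 : Real.exp (-(4 * β * δE)) / 8
        ≤ Real.exp (((2 : ℕ) : ℝ) * (-(β * (Eg - p.E₀)))) := by
      have h4 : Real.exp (-(4 * β * δE) - 2)
          ≤ Real.exp (((2 : ℕ) : ℝ) * (-(β * (Eg - p.E₀)))) := by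
        refine Real.exp_le_exp.2 ?_
        have h5 : Eg - p.E₀ ≤ 2 * δE + 1 / β := by
          change Eg - (Ehat - δE - 1 / β) ≤ _
          linarith [hEI.2]
        have h6 := mul_le_mul_of_nonneg_left h5 hβ.le
        rw [mul_add, mul_one_div_cancel hβ.ne'] at h6
        push_cast
        linarith
      refine le_trans ?_ h4
      rw [Real.exp_sub]
      refine div_le_div_of_nonneg_left (Real.exp_pos _).le (Real.exp_pos _) ?_
      have : Real.exp 2 = Real.exp 1 * Real.exp 1 := by rw [← Real.exp_add]; norm_num
      rw [this]
      nlinarith [Real.exp_one_lt_d9, Real.exp_pos 1]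
    have := mul_le_mul h3 hp hpb.le (Real.exp_pos _).le
    linarith
  have h125 : 125 * ε ≤ ketNorm v₀ ^ 2 := by linarith
  have h125η : 125 * ε ≤ η * ketNorm v₀ ^ 2 := by nlinarith
  -- `C_T ≤ e^{3/2}`, and `e⁶ < 500`.
  have hCT : CT H β p ^ 4 ≤ 500 := by
    have h1 := CT_le hH hβ hT hNt (by
      rw [hHt]
      refine le_trans ?_ (Nat.le_ceil _)
      change (htot * (2 * β * L)) ^ 2 ≤ _
      have : 0 ≤ htot ^ 2 * β ^ 2 * L ^ 2 := by positivity
      linarith)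
    refine (pow_le_pow_left₀ (CT_pos hH hβ hT hNt0).le h1 4).trans ?_
    rw [← Real.exp_nat_mul]
    have : Real.exp (((4 : ℕ) : ℝ) * (3 / 2)) = Real.exp 1 ^ 6 := by
      rw [← Real.exp_nat_mul]; norm_num
    rw [this]
    refine (pow_le_pow_left₀ (Real.exp_pos 1).le Real.exp_one_lt_d9.le 6).trans ?_
    norm_num
  have hbad : 2 * CT H β p ^ 4 / (p.Ns * ε ^ 2) < κ / 2 := by
    have h1 : 3000 * (1 / (κ * ε ^ 2)) ≤ (p.Ns : ℝ) := Nat.le_ceil _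
    have h2 : 3000 / κ ≤ p.Ns * ε ^ 2 := by
      refine le_trans (le_of_eq ?_) (mul_le_mul_of_nonneg_right h1 (by positivity))
      field_simp
    have h3 : (0 : ℝ) < p.Ns * ε ^ 2 := lt_of_lt_of_le (by positivity) h2
    rw [div_lt_iff₀ h3]
    have h4 := mul_le_mul_of_nonneg_left h2 (show 0 ≤ κ / 2 by positivity)
    have h5 : κ / 2 * (3000 / κ) = 1500 := by field_simp; norm_num
    linarith
  have b1 := measureReal_estimator_ge_le hH hβ hT hNt0 hNs0 hO hΨ hε0
  have b2 := measureReal_estimator_ge_le hH hβ hT hNt0 hNs0 hI hΨ hε0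
  -- Numerator and denominator each fail with probability below `κ / 2`.
  refine one_sub_lt_measureReal_of_compl_subset _ _ ?_
    (lt_of_le_of_lt (add_le_add b1 b2) (by linarith))
  intro ω g1 g2
  rw [Set.mem_ofPred_eq, not_le] at g1 g2
  rw [Observable.identity_aTot, one_mul] at g2
  have n1 := O.norm_braket_sub_le (by linarith) hvv hv1
  have n2 := (Observable.identity n).norm_braket_sub_le (by linarith) hvv hv1
  rw [Observable.identity_toOp, Matrix.one_mulVec, Matrix.one_mulVec, Observable.identity_aTot,
    one_mul, braket_self v₀] at n2
  rw [Observable.identity_toOp, Matrix.one_mulVec] at g2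
  have t1 : ‖estimator H β p O ω.1 - braket v₀ (O.toOp *ᵥ v₀)‖ < O.aTot * (9 * ε) := by
    have := norm_add_le (estimator H β p O ω.1 - braket v (O.toOp *ᵥ v))
      (braket v (O.toOp *ᵥ v) - braket v₀ (O.toOp *ᵥ v₀))
    rw [sub_add_sub_cancel] at this
    linarith
  have t2 : ‖estimator H β p (Observable.identity n) ω.2 - ((ketNorm v₀ ^ 2 : ℝ) : ℂ)‖
      < 9 * ε := by
    have := norm_add_le (estimator H β p (Observable.identity n) ω.2 - braket v v)
      (braket v v - ((ketNorm v₀ ^ 2 : ℝ) : ℂ))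
    rw [sub_add_sub_cancel] at this
    linarith
  have hN : ‖braket v₀ (O.toOp *ᵥ v₀)‖ ≤ O.aTot * ketNorm v₀ ^ 2 := by
    rw [pow_two]; exact O.norm_braket_le _ _
  rw [Set.mem_ofPred_eq, imagTimeMean_eq p.E₀, ← hv₀, braket_self v₀]
  exact norm_div_sub_div_lt hO hε0 hη hN h125 h125η t1 t2
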